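/- Theorem 2. For $x\in(0,1)$ irrational put $A(x)=\{1/x\}$ and $A_0(x)=\lfloor 1/x+1\rfloor-1/x$, and for irrational $x\in\mathbf{R}$ with fractional part $\{x\}$ let $$W(x)=\sum_{j\ge 0}(-1)^j\,\{x\}A(\{x\})\cdots A^{j-1}(\{x\})\,\log\frac{1}{A^j(\{x\})},\qquad B_0(x)=\sum_{j\ge 0}\{x\}A_0(\{x\})\cdots A_0^{j-1}(\{x\})\,\log\frac{1}{A_0^j(\{x\})}$$ be the Wilton function and the semi-Brjuno function, wherever the series converge. Let $W^-(x)=\frac12(W(x)-W(-x))$, $B_0^-(x)=\frac12(B_0(x)-B_0(-x))$ and $\Delta^-(x)=W^-(x)-2B_0^-(x)$, which is defined on the set $\mathcal{D}$ of all irrational $x$ at which the series for $W(x)$, $W(-x)$, $B_0(x)$ and $B_0(-x)$ all converge. Then $\mathcal{D}$ is dense in $\mathbf{R}$, and $\Delta^-$ extends from $\mathcal{D}$ to a (necessarily unique) continuous function on $\mathbf{R}\setminus\mathbf{Q}$, in particular on $(0,\frac12)\setminus\mathbf{Q}$, again denoted by $\Delta^-$, such that: (i) at every rational $p/q$ (in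 lowest terms, $q\ge1$) the one-sided limits of $\Delta^-$ along irrationals exist, and $\Delta^-(p/q^+)-\Delta^-(p/q^-)=\frac2q$; (ii) every extension of $\Delta^-$ to $\mathbf{R}$ whose value at each rational $p/q$ lies in $[\Delta^-(p/q^-),\Delta^-(p/q^+)]$ is Riemann integrable on every compact interval $[a,b]$ with $a<b$; (iii) $\Delta^-$ is nowhere differentiable: for every $x\in\mathbf{R}$, whatever value is assigned at $x$ if $x$ is rational, the difference quotients of $\Delta^-$ at $x$, taken along irrationals, do not converge to a finite limit. -/

import Mathlib

open Filter Topology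

noncomputable section

/-- The Gauss map `A(x) = {1/x}`. -/
def gaussMap (x : ℝ) : ℝ := Int.fract (1 / x)

/-- The by-excess map `A₀(x) = ⌊1/x + 1⌋ - 1/x`. -/
def byExcessMap (x : ℝ) : ℝ := (⌊1 / x + 1⌋ : ℝ) - 1 / x

/-- The `j`-th term `y T(y) ⋯ T^{j-1}(y) · log (1 / T^j(y))`, with `y = {x}`, of the Brjuno-type
series attached to the map `T`. -/
def brjunoTerm (T : ℝ → ℝ) (x : ℝ) (j : ℕ) : ℝ :=
  (∏ i ∈ Finset.range j, T^[i] (Int.fract x)) * Real.log (1 / T^[j] (Int.fract x))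

/-- The `j`-th term of the series defining the Wilton function. -/
def wiltonTerm (x : ℝ) (j : ℕ) : ℝ := (-1) ^ j * brjunoTerm gaussMap x j

/-- Convergence (of the sequence of partial sums) of the series defining `W(x)`. -/
def WiltonConverges (x : ℝ) : Prop :=
  Summable (wiltonTerm x) (SummationFilter.conditional ℕ)

/-- The Wilton function `W`: the limit of the partial sums of its series. -/
def wilton (x : ℝ) : ℝ := ∑'[SummationFilter.conditional ℕ] j, wiltonTerm x j

/-- Convergence (of the sequence of partial sums) of the series defining `B₀(x)`. -/
def SemiBrjunoConverges (x : ℝ) : Prop :=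
  Summable (brjunoTerm byExcessMap x) (SummationFilter.conditional ℕ)

/-- The semi-Brjuno function `B₀`: the limit of the partial sums of its series. -/
def semiBrjuno (x : ℝ) : ℝ := ∑'[SummationFilter.conditional ℕ] j, brjunoTerm byExcessMap x j

/-- The odd part of a function on `ℝ`. -/
def oddPart (f : ℝ → ℝ) (x : ℝ) : ℝ := (f x - f (-x)) / 2

/-- `Δ⁻ = W⁻ - 2 B₀⁻`; meaningful at the points of `deltaMinusDomain`. -/
def deltaMinus (x : ℝ) : ℝ := oddPart wilton x - 2 * oddPart semiBrjuno x

/-- The irrational points at which all four series entering `Δ⁻(x)` converge. -/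
def deltaMinusDomain : Set ℝ :=
  {x | Irrational x ∧ WiltonConverges x ∧ WiltonConverges (-x) ∧
    SemiBrjunoConverges x ∧ SemiBrjunoConverges (-x)}

/-- Riemann integrability of `F` on `[a, b]`: Mathlib's Riemann integral over boxes, for the
one-dimensional box with end points `a < b` and the usual length. -/
def RiemannIntegrableOn (F : ℝ → ℝ) (a b : ℝ) (hab : a < b) : Prop :=
  BoxIntegral.Integrable
    (⟨fun _ => a, fun _ => b, fun _ => hab⟩ : BoxIntegral.Box (Fin 1))
    BoxIntegral.IntegrationParams.Riemann (fun v => F (v 0))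
    (BoxIntegral.BoxAdditiveMap.volume : BoxIntegral.BoxAdditiveMap (Fin 1) (ℝ →L[ℝ] ℝ) ⊤)

end

/-! On `𝒟` put `F(x) = W(x) - B₀(x) + B₀(-x)`. Then `Δ⁻` is `F` minus half of `W(x) + W(-x)`, and
this even part is a continuous function of the distance to the nearest integer (`wilton_neg`). For
`x` in `(0,1)`, `F(x) = H(x) - x F(A(x))` with `H = deltaKernel` (`wilton_sub_semiBrjuno_eq`). The
Gamma function enters because `A₀`, started at `-1/u` modulo 1, runs through `-1/(u-1)`, `-1/(u-2)`,
..., and the logarithms collected on the way are summed by `Γ(u) = (u-1) Γ(u-1)`. The kernel is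
continuous on `[0,1]`, with `H(0) = 1` by a weak Stirling estimate and `H(1) = 0`.

The products `x A(x) ⋯ A^{n-1}(x)` decay geometrically, so iterating the equation gives a uniformly
convergent series `deltaSeries`, continuous at the irrationals. It equals `F` on `𝒟`: the difference
solves the homogeneous equation, and tails of the convergent series defining `W` and `B₀` force it
to vanish (`wilton_sub_semiBrjuno_eq_deltaSeries`).

At `0` the side limits are `-1` and `1`. The equation makes the jump at `t` equal to `t` times the
jump at `1/t`, so Euclid's algorithm gives `2/q` at `p/q`. Integrability is Lebesgue's criterion. A
derivative at an irrational would make the jump at a nearby `p/q` at most `|x - p/q|`, whereas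
Dirichlet supplies such `p/q` with `|x - p/q| ≤ 1/q`. Density holds because `𝒟` contains the golden
ratio and is stable under integer translations and inversion. -/

noncomputable section

/-! ### The kernel and the even part -/

/-- The defect of Stirling type `u log u - log Γ(u)`. -/
def gammaDefect (u : ℝ) : ℝ := u * Real.log u - Real.log (Real.Gamma u)

/-- The correction `-t log t + log Γ(1 + t)`, which vanishes at `0` and `1`. -/
def fractDefect (t : ℝ) : ℝ := Real.negMulLog t + Real.log (Real.Gamma (1 + t))

/-- The kernel `H` of the functional equation `F(y) = H(y) - y F(1/y)` on `[0, 1)`. -/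
def deltaKernel (y : ℝ) : ℝ :=
  if y = 0 then 1 else y * (gammaDefect (1 / y) + fractDefect (Int.fract (1 / y)))

/-- The even part correction `-t log t - (2 - t) log (1 - t)`. -/
def wiltonEven (t : ℝ) : ℝ := Real.negMulLog t - (2 - t) * Real.log (1 - t)

end

lemma gammaDefect_sub_one {u : ℝ} (hu : 1 < u) :
    gammaDefect u = gammaDefect (u - 1) + u * (Real.log u - Real.log (u - 1)) := by
  have h : Real.Gamma u = (u - 1) * Real.Gamma (u - 1) := by
    have := Real.Gamma_add_one (s := u - 1) (by linarith)
    simpa using this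
  unfold gammaDefect
  rw [h, Real.log_mul (by linarith) (Real.Gamma_pos_of_pos (by linarith)).ne']
  ring

lemma continuousAt_gammaDefect {u : ℝ} (hu : 0 < u) : ContinuousAt gammaDefect u := by
  unfold gammaDefect
  have h1 : ContinuousAt Real.Gamma u :=
    (Real.differentiableAt_Gamma fun m h => by
      have : (0 : ℝ) ≤ m := m.cast_nonneg
      linarith).continuousAt
  exact (continuousAt_id.mul (Real.continuousAt_log hu.ne')).sub
    (h1.log (Real.Gamma_pos_of_pos hu).ne')

/-- Weak Stirling, from compactness of `[1, 2]` and the recurrence: a unit step changes `gammaDefect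
u - u` by `u * d - 1` with `d = log u - log (u - 1)`. This lies in `[0, d]`, and the `d` telescope
to a logarithm. -/
lemma exists_abs_gammaDefect_sub_le :
    ∃ C : ℝ, 0 ≤ C ∧ ∀ u : ℝ, 1 ≤ u → |gammaDefect u - u| ≤ C + 2 * Real.log u := by
  have hc : ContinuousOn (fun u => gammaDefect u - u) (Set.Icc 1 2) := fun u hu =>
    ((continuousAt_gammaDefect (by linarith [hu.1])).sub continuousAt_id).continuousWithinAt
  obtain ⟨C, hC⟩ := isCompact_Icc.exists_bound_of_continuousOn hc
  have hC0 : 0 ≤ C := (norm_nonneg _).trans (hC 1 (by norm_num))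
  refine ⟨C, hC0, ?_⟩
  have base : ∀ u : ℝ, 1 ≤ u → u ≤ 2 → |gammaDefect u - u| ≤ C + 2 * Real.log u := by
    intro u h1 h2
    have := hC u ⟨h1, h2⟩
    rw [Real.norm_eq_abs] at this
    linarith [Real.log_nonneg h1]
  have key : ∀ n : ℕ, ∀ u : ℝ, 1 ≤ u → u ≤ n + 2 →
      |gammaDefect u - u| ≤ C + 2 * Real.log u := by
    intro n
    induction n with
    | zero => intro u h1 h2; exact base u h1 (by simpa using h2)
    | succ n ih =>
      intro u h1 h2
      rcases le_or_gt u 2 with h | h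
      · exact base u h1 h
      have hi := ih (u - 1) (by linarith) (by push_cast at h2; linarith)
      rw [gammaDefect_sub_one (by linarith)]
      set d := Real.log u - Real.log (u - 1) with hd
      have hu1 : 0 < u - 1 := by linarith
      have hu0 : 0 < u := by linarith
      have d1 : d * (u - 1) ≤ 1 := by
        have := Real.log_le_sub_one_of_pos (div_pos hu0 hu1)
        rw [Real.log_div hu0.ne' hu1.ne'] at this
        have h3 : d ≤ 1 / (u - 1) := by
          rw [hd]; refine this.trans_eq ?_; field_simp; ring
        rwa [le_div_iff₀ hu1] at h3
      have d2 : 1 ≤ u * d := by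
        have := Real.log_le_sub_one_of_pos (div_pos hu1 hu0)
        rw [Real.log_div hu1.ne' hu0.ne'] at this
        have h3 : 1 / u ≤ d := by
          have : 1 / u = -((u - 1) / u - 1) := by field_simp; ring
          rw [this, hd]; linarith
        rwa [div_le_iff₀ hu0, mul_comm] at h3
      have d0 : 0 ≤ d := by nlinarith
      rw [abs_le] at hi ⊢
      constructor <;> nlinarith
  intro u hu
  obtain ⟨n, hn⟩ := exists_nat_ge u
  exact key n u hu (by linarith)

lemma continuousOn_fractDefect : ContinuousOn fractDefect (Set.Icc 0 1) := by
  intro t ht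
  have h1 : ContinuousAt Real.Gamma (1 + t) :=
    (Real.differentiableAt_Gamma fun m h => by
      have : (0 : ℝ) ≤ m := m.cast_nonneg
      linarith [ht.1]).continuousAt
  have h2 : ContinuousAt (fun t => Real.Gamma (1 + t)) t :=
    ContinuousAt.comp (f := fun t => 1 + t) h1 (by fun_prop)
  exact (Real.continuous_negMulLog.continuousAt.add
    (h2.log (Real.Gamma_pos_of_pos (by linarith [ht.1])).ne')).continuousWithinAt

lemma fractDefect_zero : fractDefect 0 = 0 := by simp [fractDefect]

lemma fractDefect_one : fractDefect 1 = 0 := by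
  have : (1 : ℝ) + 1 = 2 := by norm_num
  simp [fractDefect, this]

/-- The equal end values hide the jumps of `Int.fract` at the integers; hence `deltaKernel` has no
jump at the points `1/n`. -/
lemma continuous_fractDefect_fract : Continuous fun u : ℝ => fractDefect (Int.fract u) :=
  continuousOn_fractDefect.comp_fract'' (by rw [fractDefect_zero, fractDefect_one])

lemma deltaKernel_of_ne {y : ℝ} (hy : y ≠ 0) :
    deltaKernel y = y * (gammaDefect (1 / y) + fractDefect (Int.fract (1 / y))) := if_neg hy

@[simp] lemma deltaKernel_zero : deltaKernel 0 = 1 := if_pos rfl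

@[simp] lemma deltaKernel_one : deltaKernel 1 = 0 := by
  rw [deltaKernel_of_ne one_ne_zero]
  simp [gammaDefect, fractDefect_zero]

lemma continuousOn_deltaKernel : ContinuousOn deltaKernel (Set.Icc 0 1) := by
  intro y hy
  rcases hy.1.eq_or_lt with rfl | h0
  · obtain ⟨C, hC0, hC⟩ := exists_abs_gammaDefect_sub_le
    obtain ⟨K, hK⟩ := isCompact_Icc.exists_bound_of_continuousOn continuousOn_fractDefect
    -- With `u = 1 / y`, multiplying the Stirling error `C + 2 log u` by `y` gives a bound that
    -- vanishes at `0`.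
    have hb : ∀ y ∈ Set.Icc (0 : ℝ) 1,
        |deltaKernel y - 1| ≤ (C + K) * y + 2 * Real.negMulLog y := by
      intro y hy
      rcases hy.1.eq_or_lt with rfl | h0
      · simp
      have h1 := hC (1 / y) (by rw [le_div_iff₀ h0]; linarith [hy.2])
      have h2 := hK (Int.fract (1 / y)) ⟨Int.fract_nonneg _, (Int.fract_lt_one _).le⟩
      rw [Real.norm_eq_abs] at h2
      rw [deltaKernel_of_ne h0.ne']
      have e : y * (gammaDefect (1 / y) + fractDefect (Int.fract (1 / y))) - 1 =
          y * ((gammaDefect (1 / y) - 1 / y) + fractDefect (Int.fract (1 / y))) := by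
        rw [mul_add, mul_add, mul_sub, mul_one_div_cancel h0.ne']
        ring
      rw [e, abs_mul, abs_of_pos h0]
      have h3 := (abs_add_le (gammaDefect (1 / y) - 1 / y) (fractDefect (Int.fract (1 / y)))).trans
        (add_le_add h1 h2)
      refine (mul_le_mul_of_nonneg_left h3 h0.le).trans_eq ?_
      rw [one_div, Real.log_inv, Real.negMulLog]
      ring
    have ht : Tendsto (fun y : ℝ => (C + K) * y + 2 * Real.negMulLog y) (𝓝[Set.Icc 0 1] 0)
        (𝓝 0) := by
      have : Continuous (fun y : ℝ => (C + K) * y + 2 * Real.negMulLog y) := by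
        have := Real.continuous_negMulLog
        fun_prop
      have h := (this.tendsto 0).mono_left (nhdsWithin_le_nhds (s := Set.Icc 0 1))
      simpa using h
    have := squeeze_zero_norm' (f := fun y => deltaKernel y - 1)
      (eventually_mem_nhdsWithin.mono fun y hy => by
        rw [Real.norm_eq_abs]; exact hb y hy) ht
    rw [ContinuousWithinAt, deltaKernel_zero]
    simpa using this.add_const 1
  · have h1 : ContinuousAt (fun y : ℝ => 1 / y) y :=
      continuousAt_const.div continuousAt_id h0.ne'
    have h2 : ContinuousAt (fun y : ℝ => gammaDefect (1 / y)) y :=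
      ContinuousAt.comp (f := fun y : ℝ => 1 / y) (continuousAt_gammaDefect (by positivity)) h1
    have h3 : ContinuousAt (fun y : ℝ => fractDefect (Int.fract (1 / y))) y :=
      ContinuousAt.comp (f := fun y : ℝ => 1 / y) continuous_fractDefect_fract.continuousAt h1
    have h4 : ContinuousAt (fun y : ℝ =>
        y * (gammaDefect (1 / y) + fractDefect (Int.fract (1 / y)))) y :=
      continuousAt_id.mul (h2.add h3)
    refine (h4.congr ?_).continuousWithinAt
    filter_upwards [eventually_ne_nhds h0.ne'] with z hz
    rw [deltaKernel_of_ne hz]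

lemma exists_abs_deltaKernel_le :
    ∃ M : ℝ, 0 ≤ M ∧ ∀ y ∈ Set.Icc (0 : ℝ) 1, |deltaKernel y| ≤ M := by
  obtain ⟨M, hM⟩ := isCompact_Icc.exists_bound_of_continuousOn continuousOn_deltaKernel
  exact ⟨M, (norm_nonneg _).trans (hM 0 (by norm_num)), hM⟩

lemma continuousOn_wiltonEven : ContinuousOn wiltonEven (Set.Icc 0 (1 / 2)) := by
  unfold wiltonEven
  refine Real.continuous_negMulLog.continuousOn.sub
    ((by fun_prop : Continuous fun t : ℝ => 2 - t).continuousOn.mul ?_)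
  refine (by fun_prop : Continuous fun t : ℝ => 1 - t).continuousOn.log fun x hx => ?_
  have := hx.2
  intro h
  linarith

lemma abs_sub_round_mem_Icc (x : ℝ) : |x - round x| ∈ Set.Icc (0 : ℝ) (1 / 2) :=
  ⟨abs_nonneg _, abs_sub_round x⟩

/-- The distance to the nearest integer is the norm on the circle; it stays in `[0, 1/2]`, away from
the singularity of `log (1 - t)`. -/
lemma continuous_wiltonEven_abs_sub_round : Continuous fun x : ℝ => wiltonEven |x - round x| := by
  have h1 : Continuous fun x : ℝ => |x - round x| := by
    have : (fun x : ℝ => |x - round x|) = fun x : ℝ => ‖(x : UnitAddCircle)‖ := by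
      ext x; rw [UnitAddCircle.norm_eq]
    rw [this]
    exact continuous_norm.comp (AddCircle.continuous_mk' 1)
  exact continuousOn_wiltonEven.comp_continuous h1 abs_sub_round_mem_Icc

/-! ### The series solution and its continuity at irrationals -/

noncomputable section

/-- The product `y T(y) ⋯ T^{n-1}(y)` along an orbit of `T`. -/
def orbitProd (T : ℝ → ℝ) (n : ℕ) (y : ℝ) : ℝ := ∏ i ∈ Finset.range n, T^[i] y

/-- The term of the series `deltaSeries`. -/
def deltaTerm (k : ℕ) (x : ℝ) : ℝ :=
  (-1) ^ k * orbitProd gaussMap k (Int.fract x) * deltaKernel (gaussMap^[k] (Int.fract x))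

/-- The bounded solution of `F(x) = H({x}) - {x} F(1/{x})`. -/
def deltaSeries (x : ℝ) : ℝ := ∑' k, deltaTerm k x

end

@[simp] lemma orbitProd_zero (T : ℝ → ℝ) (y : ℝ) : orbitProd T 0 y = 1 := by simp [orbitProd]

lemma orbitProd_succ (T : ℝ → ℝ) (n : ℕ) (y : ℝ) :
    orbitProd T (n + 1) y = y * orbitProd T n (T y) := by
  simp [orbitProd, Finset.prod_range_succ', mul_comm]

lemma orbitProd_add (T : ℝ → ℝ) (m n : ℕ) (y : ℝ) :
    orbitProd T (m + n) y = orbitProd T m y * orbitProd T n (T^[m] y) := by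
  induction m generalizing y with
  | zero => simp
  | succ m ih =>
    rw [show m + 1 + n = (m + n) + 1 by ring, orbitProd_succ, ih, orbitProd_succ,
      Function.iterate_succ_apply, mul_assoc]

lemma gaussMap_mem (y : ℝ) : gaussMap y ∈ Set.Ico (0 : ℝ) 1 :=
  ⟨Int.fract_nonneg _, Int.fract_lt_one _⟩

lemma gaussMap_iterate_mem {y : ℝ} (hy : y ∈ Set.Ico (0 : ℝ) 1) (n : ℕ) :
    gaussMap^[n] y ∈ Set.Ico (0 : ℝ) 1 := by
  cases n with
  | zero => exact hy
  | succ n => rw [Function.iterate_succ_apply']; exact gaussMap_mem _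

lemma fract_mem_Ico (x : ℝ) : Int.fract x ∈ Set.Ico (0 : ℝ) 1 :=
  ⟨Int.fract_nonneg _, Int.fract_lt_one _⟩

/-- With `u = 1/y` and `a = ⌊u⌋ ≥ 1`, the product is `1 - a/u`, and `u < a + 1 ≤ 2a`. -/
lemma mul_gaussMap_le {y : ℝ} (hy : y ∈ Set.Ico (0 : ℝ) 1) : y * gaussMap y ≤ 1 / 2 := by
  rcases hy.1.eq_or_lt with rfl | h0
  · simp
  have hu : 1 < 1 / y := by rw [lt_div_iff₀ h0]; linarith [hy.2]
  have ha : (1 : ℝ) ≤ ⌊1 / y⌋ := by exact_mod_cast Int.le_floor.2 (by simpa using hu.le)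
  have h1 := Int.lt_floor_add_one (1 / y)
  have h2 : y * (1 / y) = 1 := mul_one_div_cancel h0.ne'
  rw [gaussMap, Int.fract]
  nlinarith

lemma orbitProd_gaussMap_nonneg {y : ℝ} (hy : y ∈ Set.Ico (0 : ℝ) 1) (n : ℕ) :
    0 ≤ orbitProd gaussMap n y :=
  Finset.prod_nonneg fun i _ => (gaussMap_iterate_mem hy i).1

/-- Two steps gain a factor `1/2 ≤ (3/4)^2`; the constant `4/3` absorbs the case `n = 1`. -/
lemma orbitProd_gaussMap_le (n : ℕ) :
    ∀ y ∈ Set.Ico (0 : ℝ) 1, orbitProd gaussMap n y ≤ 4 / 3 * (3 / 4) ^ n := by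
  induction n using Nat.strong_induction_on with
  | _ n ih =>
    match n with
    | 0 => intro y _; norm_num
    | 1 => intro y hy; rw [orbitProd_succ]; norm_num; exact hy.2.le
    | n + 2 =>
      intro y hy
      rw [orbitProd_succ, orbitProd_succ, ← mul_assoc]
      have h1 := ih n (by omega) _ (gaussMap_mem (gaussMap y))
      have h2 := mul_gaussMap_le hy
      have h3 := orbitProd_gaussMap_nonneg (gaussMap_mem (gaussMap y)) n
      have h4 : (0 : ℝ) < (3 / 4) ^ n := by positivity
      rw [pow_add]
      nlinarith

lemma exists_abs_deltaTerm_le :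
    ∃ M : ℝ, 0 ≤ M ∧ ∀ k x, |deltaTerm k x| ≤ M * (3 / 4) ^ k := by
  obtain ⟨M, hM0, hM⟩ := exists_abs_deltaKernel_le
  refine ⟨4 / 3 * M, by positivity, fun k x => ?_⟩
  have h1 := gaussMap_iterate_mem (fract_mem_Ico x) k
  have h2 := hM _ ⟨h1.1, h1.2.le⟩
  have h3 := orbitProd_gaussMap_nonneg (fract_mem_Ico x) k
  have h4 := orbitProd_gaussMap_le k _ (fract_mem_Ico x)
  rw [deltaTerm, abs_mul, abs_mul, abs_pow, abs_neg, abs_one, one_pow, one_mul, abs_of_nonneg h3]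
  calc _ ≤ (4 / 3 * (3 / 4) ^ k) * M := mul_le_mul h4 h2 (abs_nonneg _) (by positivity)
    _ = _ := by ring

lemma summable_deltaTerm (x : ℝ) : Summable fun k => deltaTerm k x := by
  obtain ⟨M, _, hM⟩ := exists_abs_deltaTerm_le
  exact Summable.of_norm_bounded
    ((summable_geometric_of_lt_one (by norm_num) (by norm_num : (3 / 4 : ℝ) < 1)).mul_left M)
    fun k => hM k x

lemma exists_abs_deltaSeries_le : ∃ B : ℝ, 0 ≤ B ∧ ∀ x, |deltaSeries x| ≤ B := by
  obtain ⟨M, hM0, hM⟩ := exists_abs_deltaTerm_le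
  have hs := (summable_geometric_of_lt_one (by norm_num)
    (by norm_num : (3 / 4 : ℝ) < 1)).mul_left M
  refine ⟨∑' k : ℕ, M * (3 / 4) ^ k, tsum_nonneg fun k => by positivity, fun x => ?_⟩
  rw [← Real.norm_eq_abs]
  exact tsum_of_norm_bounded hs.hasSum fun k => hM k x

/-- Valid at every real, integers included, where the factor `Int.fract x` kills the last term. The
side limits below can thus be taken along all reals. -/
lemma deltaSeries_eq (x : ℝ) :
    deltaSeries x =
      deltaKernel (Int.fract x) - Int.fract x * deltaSeries (1 / Int.fract x) := by
  rw [deltaSeries, (summable_deltaTerm x).tsum_eq_zero_add, deltaSeries, ← tsum_mul_left,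
    sub_eq_add_neg, ← tsum_neg]
  congr 1
  · simp [deltaTerm]
  · congr 1
    ext k
    simp only [deltaTerm, orbitProd_succ, Function.iterate_succ_apply]
    rw [show Int.fract (1 / Int.fract x) = gaussMap (Int.fract x) from rfl]
    ring

lemma deltaSeries_fract_congr {x y : ℝ} (h : Int.fract x = Int.fract y) :
    deltaSeries x = deltaSeries y := by simp only [deltaSeries, deltaTerm, h]

lemma Irrational.fract {x : ℝ} (hx : Irrational x) : Irrational (Int.fract x) := by
  rw [Int.fract]; exact hx.sub_intCast _

lemma Irrational.fract_pos {x : ℝ} (hx : Irrational x) : 0 < Int.fract x :=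
  lt_of_le_of_ne (Int.fract_nonneg x) hx.fract.ne_zero.symm

lemma Irrational.one_div {x : ℝ} (hx : Irrational x) : Irrational (1 / x) := by
  rw [_root_.one_div]; exact hx.inv

lemma Irrational.gaussMap {x : ℝ} (hx : Irrational x) : Irrational (gaussMap x) :=
  hx.one_div.fract

lemma Irrational.gaussMap_iterate {x : ℝ} (hx : Irrational x) (n : ℕ) :
    Irrational (_root_.gaussMap^[n] x) := by
  induction n with
  | zero => exact hx
  | succ n ih => rw [Function.iterate_succ_apply']; exact ih.gaussMap

lemma Irrational.continuousAt_fract {x : ℝ} (hx : Irrational x) :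
    ContinuousAt (Int.fract : ℝ → ℝ) x :=
  _root_.continuousAt_fract (hx.ne_int _)

lemma Irrational.continuousAt_gaussMap {x : ℝ} (hx : Irrational x) :
    ContinuousAt _root_.gaussMap x :=
  ContinuousAt.comp (f := fun y : ℝ => 1 / y) hx.one_div.continuousAt_fract
    (continuousAt_const.div continuousAt_id hx.ne_zero)

lemma Irrational.continuousAt_gaussMap_iterate {x : ℝ} (hx : Irrational x) (n : ℕ) :
    ContinuousAt (_root_.gaussMap^[n]) x := by
  induction n with
  | zero => exact continuousAt_id
  | succ n ih =>
    rw [Function.iterate_succ']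
    exact ContinuousAt.comp (hx.gaussMap_iterate n).continuousAt_gaussMap ih

lemma continuousAt_deltaTerm {x : ℝ} (hx : Irrational x) (k : ℕ) :
    ContinuousAt (deltaTerm k) x := by
  have h1 : ∀ i, ContinuousAt (fun z => gaussMap^[i] (Int.fract z)) x := fun i =>
    ContinuousAt.comp (f := (Int.fract : ℝ → ℝ)) (hx.fract.continuousAt_gaussMap_iterate i)
      hx.continuousAt_fract
  have h2 : ContinuousAt (fun z => orbitProd gaussMap k (Int.fract z)) x := by
    unfold orbitProd
    exact tendsto_finsetProd _ fun i _ => h1 i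
  have hm := gaussMap_iterate_mem (fract_mem_Ico x) k
  have h0 : 0 < gaussMap^[k] (Int.fract x) :=
    lt_of_le_of_ne hm.1 (hx.fract.gaussMap_iterate k).ne_zero.symm
  have h3 : ContinuousAt deltaKernel (gaussMap^[k] (Int.fract x)) :=
    continuousOn_deltaKernel.continuousAt (Icc_mem_nhds h0 hm.2)
  exact (continuousAt_const.mul h2).mul
    (ContinuousAt.comp (f := fun z => gaussMap^[k] (Int.fract z)) h3 (h1 k))

lemma continuousOn_deltaSeries : ContinuousOn deltaSeries {x | Irrational x} := by
  obtain ⟨M, _, hM⟩ := exists_abs_deltaTerm_le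
  exact continuousOn_tsum (fun k x hx => (continuousAt_deltaTerm hx k).continuousWithinAt)
    ((summable_geometric_of_lt_one (by norm_num) (by norm_num : (3 / 4 : ℝ) < 1)).mul_left M)
    fun k x _ => hM k x

/-! ### One-sided limits at rationals -/

/-- `l` and `r` are the one-sided limits of `f` at `s`. -/
def HasSideLimits (f : ℝ → ℝ) (s l r : ℝ) : Prop :=
  Tendsto f (𝓝[<] s) (𝓝 l) ∧ Tendsto f (𝓝[>] s) (𝓝 r)

lemma HasSideLimits.sub_intCast {f : ℝ → ℝ} (hf : ∀ x y, Int.fract x = Int.fract y → f x = f y)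
    {s l r : ℝ} {n : ℤ} (h : HasSideLimits f (s - n) l r) : HasSideLimits f s l r := by
  have e : (fun x => f (x - n)) = f := by ext x; exact hf _ _ (Int.fract_sub_intCast x n)
  constructor
  · rw [← e]
    refine h.1.comp (tendsto_nhdsWithin_iff.2 ⟨?_, ?_⟩)
    · exact ((continuous_id.sub continuous_const).tendsto s).mono_left nhdsWithin_le_nhds
    · filter_upwards [self_mem_nhdsWithin] with x hx
      simpa using hx
  · rw [← e]
    refine h.2.comp (tendsto_nhdsWithin_iff.2 ⟨?_, ?_⟩)
    · exact ((continuous_id.sub continuous_const).tendsto s).mono_left nhdsWithin_le_nhds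
    · filter_upwards [self_mem_nhdsWithin] with x hx
      simpa using hx

lemma tendsto_deltaSeries_zero_right : Tendsto deltaSeries (𝓝[>] 0) (𝓝 1) := by
  obtain ⟨B, hB0, hB⟩ := exists_abs_deltaSeries_le
  have h1 : Tendsto deltaKernel (𝓝[>] 0) (𝓝 1) := by
    have := continuousOn_deltaKernel 0 (by norm_num)
    rw [ContinuousWithinAt, deltaKernel_zero] at this
    exact this.mono_left (nhdsWithin_le_iff.2 (Icc_mem_nhdsGT (by norm_num)))
  have h2 : Tendsto (fun x : ℝ => x * deltaSeries (1 / x)) (𝓝[>] 0) (𝓝 0) := by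
    have ht : Tendsto (fun x : ℝ => |x| * B) (𝓝[>] 0) (𝓝 0) := by
      have : Continuous fun x : ℝ => |x| * B := by fun_prop
      simpa using (this.tendsto 0).mono_left nhdsWithin_le_nhds
    refine squeeze_zero_norm (fun x => ?_) ht
    rw [Real.norm_eq_abs, abs_mul]
    exact mul_le_mul_of_nonneg_left (hB _) (abs_nonneg _)
  have h3 := h1.sub h2
  rw [sub_zero] at h3
  refine h3.congr' ?_
  filter_upwards [Ioo_mem_nhdsGT (zero_lt_one (α := ℝ))] with x hx
  have hx' : Int.fract x = x := Int.fract_eq_self.2 ⟨hx.1.le, hx.2⟩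
  rw [deltaSeries_eq x, hx']

lemma tendsto_one_div_left {t : ℝ} (ht : 0 < t) :
    Tendsto (fun x : ℝ => 1 / x) (𝓝[<] t) (𝓝[>] (1 / t)) := by
  refine tendsto_nhdsWithin_iff.2 ⟨?_, ?_⟩
  · exact ((continuousAt_const.div continuousAt_id ht.ne').tendsto).mono_left nhdsWithin_le_nhds
  · filter_upwards [Ioo_mem_nhdsLT ht] with x hx
    exact one_div_lt_one_div_of_lt hx.1 hx.2

lemma tendsto_one_div_right {t : ℝ} (ht : 0 < t) :
    Tendsto (fun x : ℝ => 1 / x) (𝓝[>] t) (𝓝[<] (1 / t)) := by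
  refine tendsto_nhdsWithin_iff.2 ⟨?_, ?_⟩
  · exact ((continuousAt_const.div continuousAt_id ht.ne').tendsto).mono_left nhdsWithin_le_nhds
  · filter_upwards [self_mem_nhdsWithin] with x hx
    exact one_div_lt_one_div_of_lt ht hx

lemma tendsto_deltaSeries_right_of_pos {t : ℝ} (h0 : 0 < t) (h1 : t < 1) {l : ℝ}
    (h : Tendsto deltaSeries (𝓝[<] (1 / t)) (𝓝 l)) :
    Tendsto deltaSeries (𝓝[>] t) (𝓝 (deltaKernel t - t * l)) := by
  have hk : ContinuousAt deltaKernel t := continuousOn_deltaKernel.continuousAt (Icc_mem_nhds h0 h1)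
  have h3 := (hk.tendsto.mono_left (nhdsWithin_le_nhds (s := Set.Ioi t))).sub
    ((tendsto_id.mono_left (nhdsWithin_le_nhds (s := Set.Ioi t))).mul
      (h.comp (tendsto_one_div_right h0)))
  refine h3.congr' ?_
  filter_upwards [nhdsWithin_le_nhds (Ioo_mem_nhds h0 h1)] with x hx
  have hx' : Int.fract x = x := Int.fract_eq_self.2 ⟨hx.1.le, hx.2⟩
  rw [deltaSeries_eq x, hx']
  rfl

lemma tendsto_deltaSeries_left_of_pos {t : ℝ} (h0 : 0 < t) (h1 : t ≤ 1) {r : ℝ}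
    (h : Tendsto deltaSeries (𝓝[>] (1 / t)) (𝓝 r)) :
    Tendsto deltaSeries (𝓝[<] t) (𝓝 (deltaKernel t - t * r)) := by
  have hk : Tendsto deltaKernel (𝓝[<] t) (𝓝 (deltaKernel t)) :=
    (continuousOn_deltaKernel t ⟨h0.le, h1⟩).mono_left
      (nhdsWithin_le_iff.2 (mem_of_superset (Ioo_mem_nhdsLT h0)
        fun x hx => ⟨hx.1.le, hx.2.le.trans h1⟩))
  have h3 := hk.sub
    ((tendsto_id.mono_left (nhdsWithin_le_nhds (s := Set.Iio t))).mul
      (h.comp (tendsto_one_div_left h0)))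
  refine h3.congr' ?_
  filter_upwards [Ioo_mem_nhdsLT h0] with x hx
  have hx' : Int.fract x = x := Int.fract_eq_self.2 ⟨hx.1.le, hx.2.trans_le h1⟩
  rw [deltaSeries_eq x, hx']
  rfl

/-- On the right the limit is `H(0) = 1`, since `x F(1/x)` tends to `0`. The left limit is read at
`1` by periodicity: `H(1) - F(1⁺) = 0 - 1`. -/
lemma hasSideLimits_deltaSeries_zero : HasSideLimits deltaSeries 0 (-1) 1 := by
  refine ⟨?_, tendsto_deltaSeries_zero_right⟩
  have h1 : HasSideLimits deltaSeries 1 (-1) 1 → HasSideLimits deltaSeries 0 (-1) 1 := fun h =>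
    HasSideLimits.sub_intCast (n := -1) (fun _ _ => deltaSeries_fract_congr) (by simpa using h)
  have h2 : Tendsto deltaSeries (𝓝[>] 1) (𝓝 1) := by
    have : Tendsto (fun x : ℝ => x - 1) (𝓝[>] 1) (𝓝[>] 0) := by
      refine tendsto_nhdsWithin_iff.2 ⟨?_, ?_⟩
      · have := ((continuous_id.sub continuous_const).tendsto (1 : ℝ)).mono_left
          (nhdsWithin_le_nhds (s := Set.Ioi (1 : ℝ))) (f := fun x : ℝ => x - 1)
        simpa using this
      · filter_upwards [self_mem_nhdsWithin] with x hx
        simpa using hx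
    refine (tendsto_deltaSeries_zero_right.comp this).congr fun x => ?_
    exact deltaSeries_fract_congr (by simp)
  refine (h1 ⟨?_, h2⟩).1
  have := tendsto_deltaSeries_left_of_pos one_pos le_rfl (by simpa using h2)
  simpa using this

/-- Induction on the denominator: for `t = p/q` in `(0,1)`, the inverse has denominator `p < q`. -/
theorem exists_hasSideLimits_deltaSeries (s : ℚ) :
    ∃ l r : ℝ, HasSideLimits deltaSeries s l r ∧ r - l = 2 / s.den := by
  induction hn : s.den using Nat.strong_induction_on generalizing s with
  | _ n ih =>
    subst hn
    suffices h : ∃ l r : ℝ, HasSideLimits deltaSeries ((s : ℝ) - ⌊s⌋) l r ∧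
        r - l = 2 / s.den by
      obtain ⟨l, r, h1, h2⟩ := h
      exact ⟨l, r, h1.sub_intCast fun _ _ => deltaSeries_fract_congr, h2⟩
    set t : ℚ := Int.fract s with ht
    have hts : (s : ℝ) - ⌊s⌋ = (t : ℝ) := by rw [ht, Int.fract]; push_cast; ring
    have hden : t.den = s.den := by
      rw [ht, Int.fract]
      exact Rat.sub_intCast_den s ⌊s⌋
    rw [hts, ← hden]
    have ht1 : t < 1 := Int.fract_lt_one s
    rcases (Int.fract_nonneg s).eq_or_lt with h0 | h0
    · have : t = 0 := h0.symm
      rw [this]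
      exact ⟨-1, 1, by simpa using hasSideLimits_deltaSeries_zero, by norm_num⟩
    · have h0' : 0 < t := h0
      have hinv : (t⁻¹).den = t.num.natAbs := Rat.den_inv_of_ne_zero h0'.ne'
      have hlt : t.num.natAbs < t.den := by
        have := Rat.num_lt_denom_iff.2 ht1
        have := Rat.num_pos.2 h0'
        omega
      obtain ⟨l, r, h1, h2⟩ := ih (t⁻¹).den (by rw [hinv, ← hden]; exact hlt) t⁻¹ rfl
      have e : ((t⁻¹ : ℚ) : ℝ) = 1 / (t : ℝ) := by push_cast; rw [one_div]
      rw [e] at h1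
      have p0 : (0 : ℝ) < t := by exact_mod_cast h0'
      have p1 : (t : ℝ) < 1 := by exact_mod_cast ht1
      refine ⟨_, _, ⟨tendsto_deltaSeries_left_of_pos p0 p1.le h1.2,
        tendsto_deltaSeries_right_of_pos p0 p1 h1.1⟩, ?_⟩
      -- Inversion exchanges the two sides and the equation changes the sign, so the jump keeps its
      -- sign.
      have : deltaKernel t - t * l - (deltaKernel t - t * r) = t * (r - l) := by ring
      rw [this, h2, hinv]
      have hnum : ((t.num.natAbs : ℕ) : ℝ) = t.num := by
        have := Rat.num_pos.2 h0'
        rw [Nat.cast_natAbs, abs_of_pos this]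
      rw [hnum]
      have hn0 : (t.num : ℝ) ≠ 0 := by exact_mod_cast (Rat.num_pos.2 h0').ne'
      have hd0 : (t.den : ℝ) ≠ 0 := by exact_mod_cast t.den_nz
      have : (t : ℝ) = t.num / t.den := Rat.cast_def t
      rw [this]
      field_simp

/-! ### Functions continuous at irrationals with jumps at rationals -/

lemma neBot_irrational_lt (s : ℝ) : (𝓝[{x | Irrational x ∧ x < s}] s).NeBot := by
  rw [← mem_closure_iff_nhdsWithin_neBot]
  have h := closure_mono (dense_irrational.open_subset_closure_inter (isOpen_Iio (a := s)))
  rw [closure_Iio, closure_closure] at h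
  have e : {x | Irrational x ∧ x < s} = Set.Iio s ∩ {x | Irrational x} := by
    ext x; simp [and_comm]
  rw [e]
  exact h Set.self_mem_Iic

lemma neBot_irrational_gt (s : ℝ) : (𝓝[{x | Irrational x ∧ s < x}] s).NeBot := by
  rw [← mem_closure_iff_nhdsWithin_neBot]
  have h := closure_mono (dense_irrational.open_subset_closure_inter (isOpen_Ioi (a := s)))
  rw [closure_Ioi, closure_closure] at h
  have e : {x | Irrational x ∧ s < x} = Set.Ioi s ∩ {x | Irrational x} := by
    ext x; simp [and_comm]
  rw [e]
  exact h Set.self_mem_Ici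

section

variable {D : ℝ → ℝ} {l r : ℚ → ℝ}

lemma mem_of_tendsto_left_right {s : ℚ} {K : Set ℝ} (hK : IsClosed K)
    (hl : Tendsto D (𝓝[{x | Irrational x ∧ x < s}] (s : ℝ)) (𝓝 (l s)))
    (hr : Tendsto D (𝓝[{x | Irrational x ∧ (s : ℝ) < x}] (s : ℝ)) (𝓝 (r s)))
    (h : ∀ᶠ y in 𝓝 (s : ℝ), Irrational y → D y ∈ K) : l s ∈ K ∧ r s ∈ K := by
  have := neBot_irrational_lt s
  have := neBot_irrational_gt s
  constructor
  · refine hK.mem_of_tendsto hl ?_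
    filter_upwards [nhdsWithin_le_nhds h, self_mem_nhdsWithin] with y h1 h2 using h1 h2.1
  · refine hK.mem_of_tendsto hr ?_
    filter_upwards [nhdsWithin_le_nhds h, self_mem_nhdsWithin] with y h1 h2 using h1 h2.1

/-- Near `x` the side limits at rationals lie in the same closed ball around `D x` as the values at
irrationals, and a ball contains the interval between them. -/
lemma continuousAt_of_mem_Icc_sideLimits (hc : ContinuousOn D {x | Irrational x})
    (hl : ∀ s : ℚ, Tendsto D (𝓝[{x | Irrational x ∧ x < s}] (s : ℝ)) (𝓝 (l s)))
    (hr : ∀ s : ℚ, Tendsto D (𝓝[{x | Irrational x ∧ (s : ℝ) < x}] (s : ℝ)) (𝓝 (r s)))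
    {F : ℝ → ℝ} (hF : ∀ x, Irrational x → F x = D x)
    (hFs : ∀ s : ℚ, F s ∈ Set.Icc (l s) (r s)) {x : ℝ} (hx : Irrational x) :
    ContinuousAt F x := by
  rw [Metric.continuousAt_iff]
  intro ε hε
  obtain ⟨δ, hδ, h⟩ := Metric.continuousWithinAt_iff.1 (hc x hx) (ε / 2) (by linarith)
  refine ⟨δ, hδ, fun y hy => ?_⟩
  rw [hF x hx, Real.dist_eq]
  by_cases hyi : Irrational y
  · rw [hF y hyi, ← Real.dist_eq]
    linarith [h hyi hy]
  · rw [Irrational, not_not] at hyi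
    obtain ⟨s, rfl⟩ := hyi
    obtain ⟨h1, h2⟩ := mem_of_tendsto_left_right (K := Metric.closedBall (D x) (ε / 2))
      Metric.isClosed_closedBall (hl s) (hr s) (by
        filter_upwards [Metric.isOpen_ball.mem_nhds hy] with z hz hzi
        exact (h hzi hz).le)
    rw [Metric.mem_closedBall, Real.dist_eq, abs_le] at h1 h2
    have := hFs s
    rw [abs_lt]
    constructor <;> linarith [this.1, this.2]

theorem riemannIntegrableOn_of_mem_Icc_sideLimits (hc : ContinuousOn D {x | Irrational x})
    {B : ℝ} (hB : ∀ x, |D x| ≤ B)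
    (hl : ∀ s : ℚ, Tendsto D (𝓝[{x | Irrational x ∧ x < s}] (s : ℝ)) (𝓝 (l s)))
    (hr : ∀ s : ℚ, Tendsto D (𝓝[{x | Irrational x ∧ (s : ℝ) < x}] (s : ℝ)) (𝓝 (r s)))
    {F : ℝ → ℝ} (hF : ∀ x, Irrational x → F x = D x)
    (hFs : ∀ s : ℚ, F s ∈ Set.Icc (l s) (r s)) {a b : ℝ} (hab : a < b) :
    RiemannIntegrableOn F a b hab := by
  have hb : ∀ y, |F y| ≤ B := fun y => by
    by_cases hv : Irrational y
    · rw [hF _ hv]; exact hB _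
    · rw [Irrational, not_not] at hv
      obtain ⟨s, rfl⟩ := hv
      obtain ⟨h1, h2⟩ := mem_of_tendsto_left_right (K := Set.Icc (-B) B) isClosed_Icc (hl s) (hr s)
        (Eventually.of_forall fun y _ => abs_le.1 (hB y))
      have := hFs s
      exact abs_le.2 ⟨h1.1.trans this.1, this.2.trans h2.2⟩
  have ha : ∀ᵐ v : Fin 1 → ℝ, ContinuousAt (fun v : Fin 1 → ℝ => F (v 0)) v := by
    have hcount : ((fun v : Fin 1 → ℝ => v 0) ⁻¹' Set.range ((↑) : ℚ → ℝ)).Countable :=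
      (Set.countable_range _).preimage (Equiv.funUnique (Fin 1) ℝ).injective
    filter_upwards [hcount.ae_notMem MeasureTheory.volume] with v hv
    exact ContinuousAt.comp (f := fun v : Fin 1 → ℝ => v 0)
      (continuousAt_of_mem_Icc_sideLimits hc hl hr hF hFs hv) (continuous_apply 0).continuousAt
  exact BoxIntegral.integrable_of_bounded_and_ae_continuous
    (I := (⟨fun _ => a, fun _ => b, fun _ => hab⟩ : BoxIntegral.Box (Fin 1)))
    BoxIntegral.IntegrationParams.Riemann (f := fun v : Fin 1 → ℝ => F (v 0))
    ⟨B, fun v _ => hb (v 0)⟩ MeasureTheory.volume ha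

theorem not_differentiableWithinAt_of_jump
    (hl : ∀ s : ℚ, Tendsto D (𝓝[{x | Irrational x ∧ x < s}] (s : ℝ)) (𝓝 (l s)))
    (hr : ∀ s : ℚ, Tendsto D (𝓝[{x | Irrational x ∧ (s : ℝ) < x}] (s : ℝ)) (𝓝 (r s)))
    (hj : ∀ s : ℚ, r s - l s = 2 / (s.den : ℝ))
    {F : ℝ → ℝ} (hF : ∀ x, Irrational x → F x = D x) (x : ℝ) :
    ¬ DifferentiableWithinAt ℝ F {y | Irrational y} x := by
  intro hd
  have hpos : ∀ s : ℚ, (0 : ℝ) < s.den := fun s => by exact_mod_cast s.den_pos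
  by_cases hx : Irrational x
  · obtain ⟨L, hL⟩ := hd
    have hO := (hasFDerivWithinAt_iff_isLittleO.1 hL).def (c := 1 / 2) (by norm_num)
    rw [eventually_nhdsWithin_iff, Metric.eventually_nhds_iff] at hO
    obtain ⟨δ, hδ, hO⟩ := hO
    obtain ⟨n, hn⟩ := exists_nat_one_div_lt hδ
    -- Dirichlet gives `|x - s| ≤ 1 / ((n + 2) q)`: this is used once as closeness to `x` and once
    -- as a bound by `1 / q`.
    obtain ⟨s, hs1, _⟩ := Real.exists_rat_abs_sub_le_and_den_le x (n := n + 1) (by omega)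
    have hd1 : (1 : ℝ) ≤ s.den := by exact_mod_cast s.den_pos
    have hn0 : (0 : ℝ) ≤ n := n.cast_nonneg
    have e1 : |x - s| ≤ 1 / (n + 1) := hs1.trans (by
      push_cast
      exact one_div_le_one_div_of_le (by positivity) (by nlinarith))
    have e2 : |x - s| ≤ 1 / s.den := hs1.trans (by
      push_cast
      exact one_div_le_one_div_of_le (by positivity) (by nlinarith))
    have hdist : dist (s : ℝ) x < δ := by
      rw [dist_comm, Real.dist_eq]; linarith
    -- The linear approximation passes to both side limits at `s`. Subtracting the two bounds leaves
    -- `2/q ≤ |s - x| ≤ 1/q`.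
    have bound : ∀ {f : Filter ℝ} {c : ℝ} [f.NeBot], f ≤ 𝓝 (s : ℝ) → (∀ᶠ y in f, Irrational y) →
        Tendsto D f (𝓝 c) → |c - F x - L (s - x)| ≤ 1 / 2 * |s - x| := by
      intro f c _ hf hi hc
      have h1 : Tendsto (fun y : ℝ => |D y - F x - L (y - x)|) f
          (𝓝 |c - F x - L (s - x)|) := by
        refine ((hc.sub tendsto_const_nhds).sub ?_).abs
        have : Continuous fun y : ℝ => L (y - x) := by fun_prop
        exact (this.tendsto _).mono_left hf
      have h2 : Tendsto (fun y : ℝ => 1 / 2 * |y - x|) f (𝓝 (1 / 2 * |s - x|)) := by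
        have : Continuous fun y : ℝ => 1 / 2 * |y - x| := by fun_prop
        exact (this.tendsto _).mono_left hf
      refine le_of_tendsto_of_tendsto h1 h2 ?_
      filter_upwards [hi, hf (Metric.isOpen_ball.mem_nhds hdist)] with y hy hyb
      have := hO hyb hy
      rwa [hF y hy, Real.norm_eq_abs, Real.norm_eq_abs] at this
    have := neBot_irrational_lt s
    have := neBot_irrational_gt s
    have b1 := bound nhdsWithin_le_nhds (eventually_mem_nhdsWithin.mono fun y hy => hy.1) (hl s)
    have b2 := bound nhdsWithin_le_nhds (eventually_mem_nhdsWithin.mono fun y hy => hy.1) (hr s)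
    rw [abs_le] at b1 b2
    have h3 := hj s
    rw [abs_sub_comm] at e2
    have h4 : (2 : ℝ) / s.den = 2 * (1 / s.den) := by ring
    have h5 := one_div_pos.2 (hpos s)
    linarith [b1.1, b2.2]
  · rw [Irrational, not_not] at hx
    obtain ⟨s, rfl⟩ := hx
    have := neBot_irrational_lt s
    have := neBot_irrational_gt s
    have h1 : l s = F s := tendsto_nhds_unique (hl s)
      ((hd.continuousWithinAt.mono_left (nhdsWithin_mono _ fun y hy => hy.1)).congr'
        (eventually_mem_nhdsWithin.mono fun y hy => hF y hy.1))
    have h2 : r s = F s := tendsto_nhds_unique (hr s)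
      ((hd.continuousWithinAt.mono_left (nhdsWithin_mono _ fun y hy => hy.1)).congr'
        (eventually_mem_nhdsWithin.mono fun y hy => hF y hy.1))
    have h3 := hj s
    have := div_pos two_pos (hpos s)
    linarith

end

/-! ### Convergent series along orbits -/

lemma hasSum_conditional_iff {f : ℕ → ℝ} {a : ℝ} :
    HasSum f a (SummationFilter.conditional ℕ) ↔
      Tendsto (fun n => ∑ i ∈ Finset.range n, f i) atTop (𝓝 a) := by
  rw [HasSum, SummationFilter.conditional_filter_eq_map_range, tendsto_map'_iff]
  rfl

lemma Summable.conditional {f : ℕ → ℝ} (h : Summable f) :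
    Summable f (SummationFilter.conditional ℕ) :=
  ⟨_, hasSum_conditional_iff.2 h.hasSum.tendsto_sum_nat⟩

lemma hasSum_conditional_shift_iff {f g : ℕ → ℝ} {N : ℕ} {c : ℝ}
    (h : ∀ j, f (N + j) = c * g j) (hc : c ≠ 0) {a : ℝ} :
    HasSum g a (SummationFilter.conditional ℕ) ↔
      HasSum f (∑ i ∈ Finset.range N, f i + c * a) (SummationFilter.conditional ℕ) := by
  rw [hasSum_conditional_iff, hasSum_conditional_iff, ← tendsto_add_atTop_iff_nat (f := fun n =>
    ∑ i ∈ Finset.range n, f i) N]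
  have e : ∀ n, ∑ i ∈ Finset.range (n + N), f i =
      ∑ i ∈ Finset.range N, f i + c * ∑ i ∈ Finset.range n, g i := by
    intro n
    rw [add_comm n N, Finset.sum_range_add, Finset.mul_sum]
    simp only [h]
  simp only [e]
  constructor
  · intro ht
    exact (ht.const_mul c).const_add _
  · intro ht
    have := ((ht.sub_const (∑ i ∈ Finset.range N, f i)).const_mul c⁻¹)
    simpa [← mul_assoc, inv_mul_cancel₀ hc] using this

lemma summable_conditional_shift_iff {f g : ℕ → ℝ} {N : ℕ} {c : ℝ}
    (h : ∀ j, f (N + j) = c * g j) (hc : c ≠ 0) :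
    Summable f (SummationFilter.conditional ℕ) ↔ Summable g (SummationFilter.conditional ℕ) := by
  constructor
  · rintro ⟨a, ha⟩
    refine ⟨c⁻¹ * (a - ∑ i ∈ Finset.range N, f i), (hasSum_conditional_shift_iff h hc).2 ?_⟩
    rwa [← mul_assoc, mul_inv_cancel₀ hc, one_mul, add_sub_cancel]
  · rintro ⟨a, ha⟩
    exact ⟨_, (hasSum_conditional_shift_iff h hc).1 ha⟩

lemma tsum_conditional_shift {f g : ℕ → ℝ} {N : ℕ} {c : ℝ}
    (h : ∀ j, f (N + j) = c * g j) (hc : c ≠ 0)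
    (hf : Summable f (SummationFilter.conditional ℕ)) :
    ∑'[SummationFilter.conditional ℕ] j, f j =
      ∑ i ∈ Finset.range N, f i + c * ∑'[SummationFilter.conditional ℕ] j, g j := by
  have hg := (summable_conditional_shift_iff h hc).1 hf
  exact ((hasSum_conditional_shift_iff h hc).1 hg.hasSum).tsum_eq

/-- A tail of the series for `x` is the orbit product times the series at the point reached; this
replaces boundedness of `W` and `B₀`. -/
lemma tendsto_conditional_tail {f : ℕ → ℝ} {g : ℕ → ℕ → ℝ} {N : ℕ → ℕ} {c : ℕ → ℝ}
    (h : ∀ m j, f (N m + j) = c m * g m j) (hc : ∀ m, c m ≠ 0) (hN : Tendsto N atTop atTop)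
    (hf : Summable f (SummationFilter.conditional ℕ)) :
    Tendsto (fun m => c m * ∑'[SummationFilter.conditional ℕ] j, g m j) atTop (𝓝 0) := by
  have h1 : Tendsto (fun n => ∑ i ∈ Finset.range n, f i) atTop
      (𝓝 (∑'[SummationFilter.conditional ℕ] j, f j)) := hasSum_conditional_iff.1 hf.hasSum
  have h2 := (h1.comp hN).const_sub (∑'[SummationFilter.conditional ℕ] j, f j)
  rw [sub_self] at h2
  refine h2.congr fun m => ?_
  simp only [Function.comp]
  rw [tsum_conditional_shift (h m) (hc m) hf]
  ring

lemma tendsto_zero_of_summable_conditional {f : ℕ → ℝ}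
    (hf : Summable f (SummationFilter.conditional ℕ)) : Tendsto f atTop (𝓝 0) := by
  have h1 : Tendsto (fun n => ∑ i ∈ Finset.range n, f i) atTop
      (𝓝 (∑'[SummationFilter.conditional ℕ] j, f j)) := hasSum_conditional_iff.1 hf.hasSum
  have h2 := ((tendsto_add_atTop_iff_nat 1).2 h1).sub h1
  rw [sub_self] at h2
  refine h2.congr fun n => ?_
  rw [Finset.sum_range_succ, add_sub_cancel_left]

/-- The orbit of `{x}` under `T` reaches `{x'}` after `N` steps, with product `c` on the way. -/
def OrbitReach (T : ℝ → ℝ) (x x' c : ℝ) (N : ℕ) : Prop :=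
  T^[N] (Int.fract x) = Int.fract x' ∧ orbitProd T N (Int.fract x) = c

section

variable {T : ℝ → ℝ} {x x' x'' c d : ℝ} {M N : ℕ}

lemma OrbitReach.trans (h : OrbitReach T x x' c M) (h' : OrbitReach T x' x'' d N) :
    OrbitReach T x x'' (c * d) (M + N) := by
  constructor
  · rw [add_comm, Function.iterate_add_apply, h.1, h'.1]
  · rw [orbitProd_add, h.1, h.2, h'.2]

lemma OrbitReach.refl (T : ℝ → ℝ) (x : ℝ) : OrbitReach T x x 1 0 := ⟨rfl, by simp⟩

lemma OrbitReach.congr_right (h : OrbitReach T x x' c N) (e : Int.fract x' = Int.fract x'') :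
    OrbitReach T x x'' c N := ⟨h.1.trans e, h.2⟩

lemma OrbitReach.brjunoTerm_add (h : OrbitReach T x x' c N) (j : ℕ) :
    brjunoTerm T x (N + j) = c * brjunoTerm T x' j := by
  change orbitProd T (N + j) _ * _ = c * (orbitProd T j _ * _)
  rw [orbitProd_add, h.2, add_comm N j, Function.iterate_add_apply, h.1, mul_assoc]

end

lemma WiltonConverges.congr {x y : ℝ} (h : Int.fract x = Int.fract y) :
    WiltonConverges x ↔ WiltonConverges y := by
  have : wiltonTerm x = wiltonTerm y := by ext j; simp only [wiltonTerm, brjunoTerm, h]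
  rw [WiltonConverges, WiltonConverges, this]

lemma wilton_congr {x y : ℝ} (h : Int.fract x = Int.fract y) : wilton x = wilton y := by
  simp only [wilton, wiltonTerm, brjunoTerm, h]

lemma SemiBrjunoConverges.congr {x y : ℝ} (h : Int.fract x = Int.fract y) :
    SemiBrjunoConverges x ↔ SemiBrjunoConverges y := by
  have : brjunoTerm byExcessMap x = brjunoTerm byExcessMap y := by
    ext j; simp only [brjunoTerm, h]
  rw [SemiBrjunoConverges, SemiBrjunoConverges, this]

lemma semiBrjuno_congr {x y : ℝ} (h : Int.fract x = Int.fract y) :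
    semiBrjuno x = semiBrjuno y := by
  simp only [semiBrjuno, brjunoTerm, h]

lemma fract_neg_congr {x y : ℝ} (h : Int.fract x = Int.fract y) :
    Int.fract (-x) = Int.fract (-y) := by
  obtain ⟨z, hz⟩ := Int.fract_eq_fract.1 h
  exact Int.fract_eq_fract.2 ⟨-z, by push_cast; linarith⟩

lemma fract_neg_fract (x : ℝ) : Int.fract (-Int.fract x) = Int.fract (-x) :=
  fract_neg_congr (Int.fract_fract x)

/-! The Gauss map and the Wilton function -/

lemma OrbitReach.gaussMap_iterate (x : ℝ) (N : ℕ) :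
    OrbitReach gaussMap x (gaussMap^[N] (Int.fract x)) (orbitProd gaussMap N (Int.fract x)) N :=
  ⟨(Int.fract_eq_self.2 (gaussMap_iterate_mem (fract_mem_Ico x) N)).symm, rfl⟩

lemma OrbitReach.wiltonTerm_add {x x' c : ℝ} {N : ℕ} (h : OrbitReach gaussMap x x' c N) (j : ℕ) :
    wiltonTerm x (N + j) = (-1) ^ N * c * wiltonTerm x' j := by
  rw [wiltonTerm, wiltonTerm, h.brjunoTerm_add, pow_add]
  ring

lemma orbitProd_gaussMap_ne_zero {y : ℝ} (hy : Irrational y) (n : ℕ) :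
    orbitProd gaussMap n y ≠ 0 :=
  Finset.prod_ne_zero_iff.2 fun i _ => (hy.gaussMap_iterate i).ne_zero

lemma OrbitReach.gaussMap_one {x : ℝ} (h0 : 0 < x) (h1 : x < 1) :
    OrbitReach gaussMap x (1 / x) x 1 := by
  have : Int.fract x = x := Int.fract_eq_self.2 ⟨h0.le, h1⟩
  refine ⟨by rw [this]; rfl, by rw [this, orbitProd_succ]; simp⟩

lemma wiltonConverges_one_div_iff {x : ℝ} (h0 : 0 < x) (h1 : x < 1) :
    WiltonConverges x ↔ WiltonConverges (1 / x) :=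
  summable_conditional_shift_iff (OrbitReach.gaussMap_one h0 h1).wiltonTerm_add
    (by simpa using h0.ne')

lemma wilton_eq {x : ℝ} (h0 : 0 < x) (h1 : x < 1) (h : WiltonConverges x) :
    wilton x = -Real.log x - x * wilton (1 / x) := by
  have hx : Int.fract x = x := Int.fract_eq_self.2 ⟨h0.le, h1⟩
  rw [wilton, tsum_conditional_shift (OrbitReach.gaussMap_one h0 h1).wiltonTerm_add
    (by simpa using h0.ne') h, ← wilton]
  simp [wiltonTerm, brjunoTerm, hx]
  ring

lemma tendsto_orbitProd_mul_wilton {x : ℝ} (hx : Irrational x) (h : WiltonConverges x) :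
    Tendsto (fun n => orbitProd gaussMap n (Int.fract x) * wilton (gaussMap^[n] (Int.fract x)))
      atTop (𝓝 0) := by
  have h1 := tendsto_conditional_tail (fun m => (OrbitReach.gaussMap_iterate x m).wiltonTerm_add)
    (fun m => mul_ne_zero (by simp) (orbitProd_gaussMap_ne_zero hx.fract m)) tendsto_id h
  rw [tendsto_zero_iff_abs_tendsto_zero]
  refine (tendsto_zero_iff_abs_tendsto_zero _).1 h1 |>.congr fun n => ?_
  simp only [Function.comp, abs_mul, abs_pow, abs_neg, abs_one, one_pow, one_mul, wilton]

/-- Modulo 1 the orbit of `1 - y` passes through `y / (1 - y)` and then joins that of `y` at `1 /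
y`, one step later. The opposite signs cancel the common tail `y W(1/y)` in the sum. -/
lemma wilton_reflection {y : ℝ} (h0 : 0 < y) (h1 : y < 1 / 2) :
    (WiltonConverges (1 - y) ↔ WiltonConverges y) ∧
      (WiltonConverges y → wilton y + wilton (1 - y) = wiltonEven y) := by
  have p : 0 < 1 - y := by linarith
  have q0 : 0 < y / (1 - y) := div_pos h0 p
  have q1 : y / (1 - y) < 1 := by rw [div_lt_one p]; linarith
  have e1 : Int.fract (1 / (1 - y)) = Int.fract (y / (1 - y)) :=
    Int.fract_eq_fract.2 ⟨1, by field_simp; push_cast; ring⟩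
  have e2 : Int.fract (1 / (y / (1 - y))) = Int.fract (1 / y) :=
    Int.fract_eq_fract.2 ⟨-1, by field_simp; push_cast; ring⟩
  have c1 := (wiltonConverges_one_div_iff p (by linarith)).trans (WiltonConverges.congr e1)
  have c2 := (wiltonConverges_one_div_iff q0 q1).trans (WiltonConverges.congr e2)
  have c3 := wiltonConverges_one_div_iff h0 (by linarith)
  refine ⟨c1.trans (c2.trans c3.symm), fun h => ?_⟩
  have h2 := c2.2 (c3.1 h)
  rw [wilton_eq h0 (by linarith) h, wilton_eq p (by linarith) (c1.2 h2), wilton_congr e1,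
    wilton_eq q0 q1 h2, wilton_congr e2, Real.log_div h0.ne' p.ne', wiltonEven, Real.negMulLog]
  field_simp
  ring

lemma wilton_neg {x : ℝ} (hx : Irrational x) :
    (WiltonConverges (-x) ↔ WiltonConverges x) ∧
      (WiltonConverges x → wilton x + wilton (-x) = wiltonEven |x - round x|) := by
  have f1 : Int.fract (Int.fract x) = Int.fract x := Int.fract_fract x
  have f2 : Int.fract (1 - Int.fract x) = Int.fract (-x) :=
    Int.fract_eq_fract.2 ⟨⌊x⌋ + 1, by rw [Int.fract]; push_cast; ring⟩
  have p := hx.fract_pos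
  have q := Int.fract_lt_one x
  rw [abs_sub_round_eq_min]
  rcases lt_or_ge (Int.fract x) (1 / 2) with h | h
  · rw [min_eq_left (by linarith), ← WiltonConverges.congr f1, ← WiltonConverges.congr f2,
      ← wilton_congr f1, ← wilton_congr f2]
    exact wilton_reflection p h
  · have hne : Int.fract x ≠ 1 / 2 := by
      have := hx.fract.ne_rat (1 / 2)
      push_cast at this
      exact this
    have h' : 1 - Int.fract x < 1 / 2 := by
      have := lt_of_le_of_ne h hne.symm
      linarith
    have := wilton_reflection (y := 1 - Int.fract x) (by linarith) h'
    rw [sub_sub_cancel, WiltonConverges.congr f1, WiltonConverges.congr f2, wilton_congr f1,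
      wilton_congr f2] at this
    rw [min_eq_right (by linarith)]
    exact ⟨this.1.symm, fun hc => by rw [add_comm]; exact this.2 (this.1.1 hc)⟩

/-! ### The by-excess map and the semi-Brjuno function -/

lemma byExcessMap_eq {y : ℝ} (hy : Irrational y) : byExcessMap y = Int.fract (-1 / y) := by
  have h : Int.fract (1 / y) ≠ 0 := hy.one_div.fract.ne_zero
  rw [neg_div, Int.fract_neg h, byExcessMap, Int.floor_add_one, Int.fract]
  push_cast
  ring

lemma Irrational.neg_one_div {x : ℝ} (hx : Irrational x) : Irrational (-1 / x) := by
  rw [neg_div]; exact hx.one_div.neg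

lemma OrbitReach.byExcessMap_one {x : ℝ} (hx : Irrational x) :
    OrbitReach byExcessMap x (-1 / Int.fract x) (Int.fract x) 1 :=
  ⟨byExcessMap_eq hx.fract, by rw [orbitProd_succ]; simp⟩

lemma OrbitReach.byExcessMap_sub_one {u : ℝ} (hu : Irrational u) (h1 : 1 < u) :
    OrbitReach byExcessMap (-1 / u) (-1 / (u - 1)) ((u - 1) / u) 1 ∧
      Int.fract (-1 / u) = (u - 1) / u := by
  have u0 : 0 < u := by linarith
  have hf : Int.fract (-1 / u) = (u - 1) / u := by
    refine Int.fract_eq_iff.2 ⟨by apply div_nonneg <;> linarith, ?_, -1, ?_⟩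
    · rw [div_lt_one u0]; linarith
    · field_simp; push_cast; ring
  have h := OrbitReach.byExcessMap_one hu.neg_one_div
  rw [hf] at h
  refine ⟨h.congr_right (Int.fract_eq_fract.2 ⟨-1, ?_⟩), hf⟩
  have : u - 1 ≠ 0 := by linarith
  field_simp
  push_cast
  ring

lemma OrbitReach.byExcessMap_add_nat {v : ℝ} (hv : Irrational v) (h0 : 0 < v) (n : ℕ) :
    OrbitReach byExcessMap (-1 / (v + n)) (-1 / v) (v / (v + n)) n := by
  induction n with
  | zero => simpa [h0.ne'] using OrbitReach.refl byExcessMap (-1 / v)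
  | succ n ih =>
    have hn : (0 : ℝ) ≤ n := n.cast_nonneg
    have h := (OrbitReach.byExcessMap_sub_one (u := v + (n + 1 : ℕ)) (hv.add_natCast _)
      (by push_cast; linarith)).1
    have e : v + ((n + 1 : ℕ) : ℝ) - 1 = v + n := by push_cast; ring
    rw [e] at h
    have := h.trans ih
    rw [add_comm 1 n] at this
    convert this using 1
    have : v + (n : ℝ) ≠ 0 := by linarith
    field_simp

lemma semiBrjunoConverges_iff {x x' c : ℝ} {N : ℕ} (h : OrbitReach byExcessMap x x' c N)
    (hc : c ≠ 0) : SemiBrjunoConverges x ↔ SemiBrjunoConverges x' :=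
  summable_conditional_shift_iff h.brjunoTerm_add hc

lemma semiBrjuno_eq_of_reach_one {x x' c : ℝ} (h : OrbitReach byExcessMap x x' c 1)
    (hc : c ≠ 0) (hx : SemiBrjunoConverges x) :
    semiBrjuno x = -Real.log (Int.fract x) + c * semiBrjuno x' := by
  rw [semiBrjuno, tsum_conditional_shift h.brjunoTerm_add hc hx, ← semiBrjuno]
  simp [brjunoTerm]

lemma OrbitReach.byExcessMap_neg_gaussMap {x : ℝ} (hx : Irrational x) (h0 : 0 < x) (h1 : x < 1) :
    OrbitReach byExcessMap x (-gaussMap x) x 1 := by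
  have h := OrbitReach.byExcessMap_one hx
  rw [Int.fract_eq_self.2 ⟨h0.le, h1⟩] at h
  refine h.congr_right ?_
  rw [neg_div]
  exact (fract_neg_fract _).symm

lemma exists_one_div_eq {x : ℝ} (h0 : 0 < x) (h1 : x < 1) :
    ∃ n : ℕ, 1 ≤ n ∧ 1 / x = gaussMap x + n := by
  have hu : 1 < 1 / x := by rw [lt_div_iff₀ h0]; linarith
  have ha : (1 : ℤ) ≤ ⌊1 / x⌋ := Int.le_floor.2 (by simpa using hu.le)
  obtain ⟨n, hn⟩ := Int.eq_ofNat_of_zero_le (by omega : 0 ≤ ⌊1 / x⌋)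
  refine ⟨n, by omega, ?_⟩
  have := Int.fract_add_floor (1 / x)
  rw [hn] at this
  exact this.symm

lemma Irrational.gaussMap_pos {x : ℝ} (hx : Irrational x) : 0 < _root_.gaussMap x :=
  hx.one_div.fract_pos

/-- Starting from `-x = -1/(A(x) + n)`, `n` by-excess steps lead to `-1/A(x)`, which is `-A²(x)`
modulo 1. So negative points follow the Gauss orbit two steps at a time. -/
lemma OrbitReach.byExcessMap_neg {x : ℝ} (hx : Irrational x) (h0 : 0 < x) (h1 : x < 1) :
    ∃ N, 1 ≤ N ∧ OrbitReach byExcessMap (-x) (-gaussMap (gaussMap x)) (x * gaussMap x) N := by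
  obtain ⟨n, hn, e⟩ := exists_one_div_eq h0 h1
  refine ⟨n, hn, ?_⟩
  have h := OrbitReach.byExcessMap_add_nat hx.gaussMap hx.gaussMap_pos n
  rw [← e] at h
  have e1 : -1 / (1 / x) = -x := by field_simp
  have e2 : gaussMap x / (1 / x) = x * gaussMap x := by field_simp
  rw [e1, e2] at h
  refine h.congr_right ?_
  rw [neg_div]
  exact (fract_neg_fract _).symm

lemma OrbitReach.byExcessMap_neg_iterate {x : ℝ} (hx : Irrational x) (h0 : 0 < x) (h1 : x < 1)
    (m : ℕ) :
    ∃ N, m ≤ N ∧ OrbitReach byExcessMap (-x) (-gaussMap^[2 * m] x)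
      (orbitProd gaussMap (2 * m) x) N := by
  induction m generalizing x with
  | zero => exact ⟨0, le_rfl, by simpa using OrbitReach.refl byExcessMap (-x)⟩
  | succ m ih =>
    obtain ⟨N, hN, h⟩ := OrbitReach.byExcessMap_neg hx h0 h1
    obtain ⟨N', hN', h'⟩ := ih hx.gaussMap.gaussMap hx.gaussMap.gaussMap_pos (gaussMap_mem _).2
    refine ⟨N + N', by omega, ?_⟩
    have := h.trans h'
    rwa [mul_assoc, ← orbitProd_succ, ← orbitProd_succ] at this

lemma tendsto_orbitProd_mul_semiBrjuno_neg {x : ℝ} (hx : Irrational x) (h0 : 0 < x) (h1 : x < 1)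
    (h : SemiBrjunoConverges (-x)) :
    Tendsto (fun m => orbitProd gaussMap (2 * m) x * semiBrjuno (-gaussMap^[2 * m] x))
      atTop (𝓝 0) := by
  choose N hN hr using OrbitReach.byExcessMap_neg_iterate hx h0 h1
  exact tendsto_conditional_tail (fun m => (hr m).brjunoTerm_add)
    (fun m => orbitProd_gaussMap_ne_zero hx _) (tendsto_atTop_mono hN tendsto_id) h

/-- Both `u B₀(-1/u)` and `gammaDefect u` grow by `u (log u - log (u - 1))` from `u - 1` to `u`. -/
lemma semiBrjuno_neg_one_div_add_nat {v : ℝ} (hv : Irrational v) (h0 : 0 < v) (n : ℕ)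
    (h : SemiBrjunoConverges (-1 / v)) :
    (v + n) * semiBrjuno (-1 / (v + n)) - gammaDefect (v + n) =
      v * semiBrjuno (-1 / v) - gammaDefect v := by
  induction n with
  | zero => simp
  | succ n ih =>
    rw [← ih]
    have hn : (0 : ℝ) ≤ n := n.cast_nonneg
    have hu : 1 < v + (n + 1 : ℕ) := by push_cast; linarith
    obtain ⟨hr, hf⟩ := OrbitReach.byExcessMap_sub_one (hv.add_natCast (n + 1)) hu
    have e : v + ((n + 1 : ℕ) : ℝ) - 1 = v + n := by push_cast; ring
    have hc : SemiBrjunoConverges (-1 / (v + (n + 1 : ℕ))) :=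
      (semiBrjunoConverges_iff (OrbitReach.byExcessMap_add_nat hv h0 (n + 1))
        (by positivity)).2 h
    have p1 : v + (n : ℝ) ≠ 0 := by linarith
    have p2 : v + ((n + 1 : ℕ) : ℝ) ≠ 0 := by linarith
    rw [semiBrjuno_eq_of_reach_one hr (by rw [e]; positivity) hc, hf, gammaDefect_sub_one hu, e,
      Real.log_div p1 p2]
    field_simp
    ring

lemma fractDefect_eq {t : ℝ} (ht : 0 < t) : fractDefect t = Real.log t - gammaDefect t := by
  rw [fractDefect, gammaDefect, add_comm 1 t, Real.Gamma_add_one ht.ne',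
    Real.log_mul ht.ne' (Real.Gamma_pos_of_pos ht).ne', Real.negMulLog]
  ring

lemma semiBrjunoConverges_neg_iff {x : ℝ} (hx : Irrational x) (h0 : 0 < x) (h1 : x < 1) :
    SemiBrjunoConverges (-x) ↔ SemiBrjunoConverges (gaussMap x) := by
  obtain ⟨N, -, hN⟩ := OrbitReach.byExcessMap_neg hx h0 h1
  exact (semiBrjunoConverges_iff hN (mul_pos h0 hx.gaussMap_pos).ne').trans
    (semiBrjunoConverges_iff (OrbitReach.byExcessMap_neg_gaussMap hx.gaussMap hx.gaussMap_pos
      (gaussMap_mem x).2) hx.gaussMap_pos.ne').symm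

lemma semiBrjunoConverges_iff_neg_gaussMap {x : ℝ} (hx : Irrational x) (h0 : 0 < x) (h1 : x < 1) :
    SemiBrjunoConverges x ↔ SemiBrjunoConverges (-gaussMap x) :=
  semiBrjunoConverges_iff (OrbitReach.byExcessMap_neg_gaussMap hx h0 h1) h0.ne'

lemma semiBrjuno_eq {x : ℝ} (hx : Irrational x) (h0 : 0 < x) (h1 : x < 1)
    (h : SemiBrjunoConverges x) :
    semiBrjuno x = -Real.log x + x * semiBrjuno (-gaussMap x) := by
  rw [semiBrjuno_eq_of_reach_one (OrbitReach.byExcessMap_neg_gaussMap hx h0 h1) h0.ne' h,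
    Int.fract_eq_self.2 ⟨h0.le, h1⟩]

lemma semiBrjuno_neg {x : ℝ} (hx : Irrational x) (h0 : 0 < x) (h1 : x < 1)
    (h : SemiBrjunoConverges (-x)) :
    semiBrjuno (-x) = deltaKernel x + x * semiBrjuno (gaussMap x) := by
  have hc := (semiBrjunoConverges_neg_iff hx h0 h1).1 h
  have hy := hx.gaussMap
  have hy0 := hx.gaussMap_pos
  have hy1 := (gaussMap_mem x).2
  obtain ⟨n, hn, e⟩ := exists_one_div_eq h0 h1
  have hfr : Int.fract (-1 / gaussMap x) = Int.fract (-gaussMap (gaussMap x)) := by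
    rw [neg_div]; exact (fract_neg_fract _).symm
  have h2 := semiBrjuno_neg_one_div_add_nat hy hy0 n ((SemiBrjunoConverges.congr hfr).2
    ((semiBrjunoConverges_iff_neg_gaussMap hy hy0 hy1).1 hc))
  have h3 := semiBrjuno_eq hy hy0 hy1 hc
  have e1 : -1 / (1 / x) = -x := by field_simp
  rw [← e, e1, semiBrjuno_congr hfr] at h2
  have h4 : semiBrjuno (-x) = x * (1 / x * semiBrjuno (-x)) := by field_simp
  rw [deltaKernel_of_ne h0.ne', show Int.fract (1 / x) = gaussMap x from rfl,
    fractDefect_eq hy0, h3, h4, eq_add_of_sub_eq h2]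
  ring

/-! ### Invariance and density of the domain -/

lemma deltaMinusDomain_congr {x y : ℝ} (h : Int.fract x = Int.fract y) :
    x ∈ deltaMinusDomain ↔ y ∈ deltaMinusDomain := by
  have hi : Irrational x ↔ Irrational y := by
    obtain ⟨z, hz⟩ := Int.fract_eq_fract.1 h
    rw [← irrational_add_intCast_iff (x := y) (m := z), show y + z = x by linarith]
  have h' := fract_neg_congr h
  simp only [deltaMinusDomain, Set.mem_ofPred_eq, hi, WiltonConverges.congr h,
    WiltonConverges.congr h', SemiBrjunoConverges.congr h, SemiBrjunoConverges.congr h']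

lemma neg_mem_deltaMinusDomain {x : ℝ} (h : x ∈ deltaMinusDomain) : -x ∈ deltaMinusDomain := by
  obtain ⟨h1, h2, h3, h4, h5⟩ := h
  exact ⟨h1.neg, h3, by rwa [neg_neg], h5, by rwa [neg_neg]⟩

/-- The Gauss map exchanges the convergence conditions on `B₀(x)` and `B₀(-x)`, so it is essential
that both are required. -/
lemma gaussMap_mem_deltaMinusDomain_iff {x : ℝ} (hx : Irrational x) (h0 : 0 < x) (h1 : x < 1) :
    gaussMap x ∈ deltaMinusDomain ↔ x ∈ deltaMinusDomain := by
  have e1 : Int.fract (1 / x) = Int.fract (gaussMap x) := (Int.fract_fract _).symm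
  have w := (wiltonConverges_one_div_iff h0 h1).trans (WiltonConverges.congr e1)
  simp only [deltaMinusDomain, Set.mem_ofPred_eq, hx, hx.gaussMap, (wilton_neg hx).1,
    (wilton_neg hx.gaussMap).1, w, semiBrjunoConverges_neg_iff hx h0 h1,
    semiBrjunoConverges_iff_neg_gaussMap hx h0 h1]
  tauto

lemma one_div_mem_deltaMinusDomain {x : ℝ} (h : x ∈ deltaMinusDomain) :
    1 / x ∈ deltaMinusDomain := by
  have pos : ∀ x ∈ deltaMinusDomain, 0 < x → 1 / x ∈ deltaMinusDomain := by
    intro x h h0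
    have e : ∀ z : ℝ, Int.fract (1 / z) = Int.fract (gaussMap z) := fun z =>
      (Int.fract_fract _).symm
    have hx : Irrational x := h.1
    rcases lt_or_ge x 1 with h1 | h1
    · exact (deltaMinusDomain_congr (e x)).2 ((gaussMap_mem_deltaMinusDomain_iff hx h0 h1).2 h)
    · have h1' : 1 < x := lt_of_le_of_ne h1 hx.ne_one.symm
      refine (gaussMap_mem_deltaMinusDomain_iff hx.one_div (by positivity) ?_).1
        ((deltaMinusDomain_congr (e _)).1 (by rwa [one_div_one_div]))
      rw [div_lt_one h0]
      exact h1'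
  have hx : Irrational x := h.1
  rcases lt_or_gt_of_ne hx.ne_zero with h0 | h0
  · have := neg_mem_deltaMinusDomain (pos _ (neg_mem_deltaMinusDomain h) (by linarith))
    rwa [div_neg, neg_neg] at this
  · exact pos x h h0

/-- At a fixed point the series is geometric. It serves the golden ratio `g`, as `{g}` is fixed by
`A` and `{-g}` by `A₀`. -/
lemma summable_brjunoTerm_of_fixed {T : ℝ → ℝ} {x : ℝ} (hT : T (Int.fract x) = Int.fract x) :
    Summable fun j => |brjunoTerm T x j| := by
  have e : ∀ j, brjunoTerm T x j = Int.fract x ^ j * Real.log (1 / Int.fract x) := by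
    intro j
    have : ∀ i, T^[i] (Int.fract x) = Int.fract x := fun i => Function.iterate_fixed hT i
    simp [brjunoTerm, this]
  simp only [e]
  exact ((summable_geometric_of_lt_one (Int.fract_nonneg x)
    (Int.fract_lt_one x)).mul_right _).abs

lemma goldenRatio_mem_deltaMinusDomain : Real.goldenRatio ∈ deltaMinusDomain := by
  have hi := Real.goldenRatio_irrational
  have h2 := Real.goldenRatio_sq
  have hlt := Real.one_lt_goldenRatio
  have hlt2 := Real.goldenRatio_lt_two
  set g := Real.goldenRatio
  have h0 : 0 < g := by linarith
  have hf : Int.fract g = g - 1 := Int.fract_eq_iff.2 ⟨by linarith, by linarith, 1, by simp⟩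
  have hf' : Int.fract (-g) = 2 - g :=
    Int.fract_eq_iff.2 ⟨by linarith, by linarith, -2, by push_cast; ring⟩
  have hinv : 1 / (g - 1) = g := by
    rw [div_eq_iff (by linarith)]; nlinarith
  have hinv' : -1 / (2 - g) = -g - 1 := by
    rw [div_eq_iff (by linarith)]; nlinarith
  have hw : WiltonConverges g := by
    have := summable_brjunoTerm_of_fixed (T := gaussMap) (x := g) (by
      rw [hf, gaussMap, hinv, hf])
    refine Summable.conditional (Summable.of_norm ?_)
    refine this.congr fun j => ?_
    rw [Real.norm_eq_abs, wiltonTerm, abs_mul, abs_pow, abs_neg, abs_one, one_pow, one_mul]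
  have hb : SemiBrjunoConverges (-g) := by
    refine Summable.conditional (Summable.of_norm (summable_brjunoTerm_of_fixed ?_))
    rw [byExcessMap_eq hi.neg.fract, hf', hinv', ← hf']
    exact Int.fract_sub_one _
  refine ⟨hi, hw, (wilton_neg hi).1.2 hw, ?_, hb⟩
  refine (semiBrjunoConverges_iff (OrbitReach.byExcessMap_one hi) hi.fract_pos.ne').2 ?_
  rw [hf, neg_div, hinv]
  exact hb

lemma sub_intCast_mem_closure_deltaMinusDomain {x : ℝ} (n : ℤ)
    (h : x - n ∈ closure deltaMinusDomain) : x ∈ closure deltaMinusDomain := by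
  have := map_mem_closure (f := fun z : ℝ => z + n) (by fun_prop) h
    (t := deltaMinusDomain) fun z hz => (deltaMinusDomain_congr (Int.fract_add_intCast z n)).2 hz
  simpa using this

lemma one_div_mem_closure_deltaMinusDomain {x : ℝ} (hx : x ≠ 0)
    (h : x ∈ closure deltaMinusDomain) : 1 / x ∈ closure deltaMinusDomain :=
  ContinuousWithinAt.mem_closure (f := fun z : ℝ => 1 / z)
    (continuousAt_const.div continuousAt_id hx).continuousWithinAt h
    fun _ hz => one_div_mem_deltaMinusDomain hz

lemma zero_mem_closure_deltaMinusDomain : (0 : ℝ) ∈ closure deltaMinusDomain := by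
  have ht : Tendsto (fun n : ℕ => 1 / (Real.goldenRatio + (n : ℝ))) atTop (𝓝 0) := by
    simp only [one_div]
    exact (tendsto_atTop_add_const_left _ _ tendsto_natCast_atTop_atTop).inv_tendsto_atTop
  refine mem_closure_of_tendsto ht (Eventually.of_forall fun n => ?_)
  exact one_div_mem_deltaMinusDomain
    ((deltaMinusDomain_congr (Int.fract_add_natCast _ n)).2 goldenRatio_mem_deltaMinusDomain)

lemma ratCast_mem_closure_deltaMinusDomain (s : ℚ) : (s : ℝ) ∈ closure deltaMinusDomain := by
  induction hn : s.den using Nat.strong_induction_on generalizing s with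
  | _ n ih =>
    subst hn
    refine sub_intCast_mem_closure_deltaMinusDomain ⌊s⌋ ?_
    set t : ℚ := Int.fract s with ht
    have hts : (s : ℝ) - ⌊s⌋ = (t : ℝ) := by rw [ht, Int.fract]; push_cast; ring
    have hden : t.den = s.den := Rat.sub_intCast_den s ⌊s⌋
    rw [hts]
    have ht1 : t < 1 := Int.fract_lt_one s
    rcases (Int.fract_nonneg s).eq_or_lt with h0 | h0
    · rw [ht, ← h0, Rat.cast_zero]
      exact zero_mem_closure_deltaMinusDomain
    · have h0' : 0 < t := h0
      have hlt : t.num.natAbs < t.den := by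
        have := Rat.num_lt_denom_iff.2 ht1
        have := Rat.num_pos.2 h0'
        omega
      have := ih (t⁻¹).den (by rw [Rat.den_inv_of_ne_zero h0'.ne', ← hden]; exact hlt) t⁻¹ rfl
      have hne : ((t⁻¹ : ℚ) : ℝ) ≠ 0 := by exact_mod_cast (inv_pos.2 h0').ne'
      have := one_div_mem_closure_deltaMinusDomain hne this
      rwa [one_div, Rat.cast_inv, inv_inv] at this

theorem dense_deltaMinusDomain : Dense deltaMinusDomain := by
  have h : Dense (Set.range ((↑) : ℚ → ℝ)) := Rat.denseRange_cast
  have h' : Dense (closure deltaMinusDomain) :=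
    h.mono (by rintro _ ⟨s, rfl⟩; exact ratCast_mem_closure_deltaMinusDomain s)
  exact dense_closure.1 h'

/-! ### Identification with the series solution -/

lemma gaussMap_iterate_mem_deltaMinusDomain {x : ℝ} (hx : x ∈ deltaMinusDomain) (h0 : 0 < x)
    (h1 : x < 1) (n : ℕ) :
    gaussMap^[n] x ∈ deltaMinusDomain ∧ 0 < gaussMap^[n] x ∧ gaussMap^[n] x < 1 := by
  induction n with
  | zero => exact ⟨hx, h0, h1⟩
  | succ n ih =>
    rw [Function.iterate_succ_apply']
    have := (gaussMap_mem_deltaMinusDomain_iff ih.1.1 ih.2.1 ih.2.2).2 ih.1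
    exact ⟨this, Irrational.gaussMap_pos ih.1.1, (gaussMap_mem _).2⟩

lemma wilton_sub_semiBrjuno_eq {x : ℝ} (hx : x ∈ deltaMinusDomain) (h0 : 0 < x) (h1 : x < 1) :
    wilton x - semiBrjuno x + semiBrjuno (-x) = deltaKernel x - x *
      (wilton (gaussMap x) - semiBrjuno (gaussMap x) + semiBrjuno (-gaussMap x)) := by
  obtain ⟨hi, hw, -, hb, hb'⟩ := hx
  rw [wilton_eq h0 h1 hw, semiBrjuno_eq hi h0 h1 hb, semiBrjuno_neg hi h0 h1 hb',
    show wilton (1 / x) = wilton (gaussMap x) from wilton_congr (Int.fract_fract _).symm]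
  ring

/-- One by-excess step splits the quantity into a term of the series for `W(x)` and `x` times a tail
of the series for `B₀(-A(x))`; both tend to `0`. -/
lemma tendsto_orbitProd_mul_semiBrjuno {x : ℝ} (hx : x ∈ deltaMinusDomain) (h0 : 0 < x)
    (h1 : x < 1) :
    Tendsto (fun m => orbitProd gaussMap (2 * m) x * semiBrjuno (gaussMap^[2 * m] x))
      atTop (𝓝 0) := by
  have hi : Irrational x := hx.1
  have hd := (gaussMap_mem_deltaMinusDomain_iff hi h0 h1).2 hx
  have hf : Int.fract x = x := Int.fract_eq_self.2 ⟨h0.le, h1⟩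
  have t1 := ((tendsto_orbitProd_mul_semiBrjuno_neg hd.1 hi.gaussMap_pos (gaussMap_mem x).2
    hd.2.2.2.2).const_mul x)
  have t2 : Tendsto (fun m : ℕ => wiltonTerm x (2 * m)) atTop (𝓝 0) :=
    (tendsto_zero_of_summable_conditional hx.2.1).comp
      (tendsto_atTop_mono (fun m => Nat.le_mul_of_pos_left m two_pos) tendsto_id)
  have t3 := t2.add t1
  rw [mul_zero, add_zero] at t3
  refine t3.congr fun m => ?_
  obtain ⟨hm, p0, p1⟩ := gaussMap_iterate_mem_deltaMinusDomain hx h0 h1 (2 * m)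
  rw [semiBrjuno_eq hm.1 p0 p1 hm.2.2.2.1, ← Function.iterate_succ_apply' gaussMap (2 * m) x,
    Function.iterate_succ_apply]
  have e1 : wiltonTerm x (2 * m) = orbitProd gaussMap (2 * m) x * -Real.log (gaussMap^[2 * m] x) := by
    simp [wiltonTerm, brjunoTerm, hf, orbitProd]
  have e2 : x * orbitProd gaussMap (2 * m) (gaussMap x) =
      orbitProd gaussMap (2 * m) x * gaussMap^[2 * m] x := by
    rw [← orbitProd_succ, orbitProd_add]
    simp [orbitProd]
  rw [e1, ← mul_assoc, e2]
  ring

lemma wilton_sub_semiBrjuno_sub_deltaSeries_iterate {x : ℝ} (hx : x ∈ deltaMinusDomain)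
    (h0 : 0 < x) (h1 : x < 1) (n : ℕ) :
    wilton x - semiBrjuno x + semiBrjuno (-x) - deltaSeries x =
      (-1) ^ n * (orbitProd gaussMap n x *
        (wilton (gaussMap^[n] x) - semiBrjuno (gaussMap^[n] x) + semiBrjuno (-gaussMap^[n] x) -
          deltaSeries (gaussMap^[n] x))) := by
  induction n generalizing x with
  | zero => simp
  | succ n ih =>
    have hi : Irrational x := hx.1
    have e : deltaSeries (1 / x) = deltaSeries (gaussMap x) :=
      deltaSeries_fract_congr (Int.fract_fract _).symm
    have h2 := ih ((gaussMap_mem_deltaMinusDomain_iff hi h0 h1).2 hx) hi.gaussMap_pos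
      (gaussMap_mem x).2
    rw [wilton_sub_semiBrjuno_eq hx h0 h1, deltaSeries_eq x, Int.fract_eq_self.2 ⟨h0.le, h1⟩, e,
      orbitProd_succ, Function.iterate_succ_apply, pow_succ]
    linear_combination -x * h2

theorem wilton_sub_semiBrjuno_eq_deltaSeries {x : ℝ} (hx : x ∈ deltaMinusDomain)
    (h0 : 0 < x) (h1 : x < 1) :
    wilton x - semiBrjuno x + semiBrjuno (-x) = deltaSeries x := by
  have hi : Irrational x := hx.1
  have hf : Int.fract x = x := Int.fract_eq_self.2 ⟨h0.le, h1⟩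
  -- Only even indices are available, because negative points advance by two Gauss steps; they
  -- suffice, the iterated difference being constant up to sign.
  have h2 : Tendsto (fun m : ℕ => 2 * m) atTop atTop :=
    tendsto_atTop_mono (fun m => Nat.le_mul_of_pos_left m two_pos) tendsto_id
  have t1 := (tendsto_orbitProd_mul_wilton hi hx.2.1).comp h2
  rw [hf] at t1
  have t2 := tendsto_orbitProd_mul_semiBrjuno hx h0 h1
  have t3 := tendsto_orbitProd_mul_semiBrjuno_neg hi h0 h1 hx.2.2.2.2
  have t4 : Tendsto (fun m => orbitProd gaussMap (2 * m) x * deltaSeries (gaussMap^[2 * m] x))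
      atTop (𝓝 0) := by
    obtain ⟨B, hB0, hB⟩ := exists_abs_deltaSeries_le
    have hg : Tendsto (fun n : ℕ => 4 / 3 * (3 / 4 : ℝ) ^ n * B) atTop (𝓝 0) := by
      have := ((tendsto_pow_atTop_nhds_zero_of_lt_one (by norm_num)
        (by norm_num : (3 / 4 : ℝ) < 1)).const_mul (4 / 3)).mul_const B
      simpa using this
    refine squeeze_zero_norm (fun m => ?_) (hg.comp h2)
    rw [Real.norm_eq_abs, abs_mul, abs_of_nonneg (orbitProd_gaussMap_nonneg ⟨h0.le, h1⟩ _)]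
    exact mul_le_mul (orbitProd_gaussMap_le _ _ ⟨h0.le, h1⟩) (hB _) (abs_nonneg _) (by positivity)
  have t5 := ((t1.sub t2).add t3).sub t4
  simp only [sub_zero, add_zero] at t5
  have e : ∀ m : ℕ, orbitProd gaussMap (2 * m) x * wilton (gaussMap^[2 * m] x) -
      orbitProd gaussMap (2 * m) x * semiBrjuno (gaussMap^[2 * m] x) +
      orbitProd gaussMap (2 * m) x * semiBrjuno (-gaussMap^[2 * m] x) -
      orbitProd gaussMap (2 * m) x * deltaSeries (gaussMap^[2 * m] x) =
      wilton x - semiBrjuno x + semiBrjuno (-x) - deltaSeries x := by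
    intro m
    rw [wilton_sub_semiBrjuno_sub_deltaSeries_iterate hx h0 h1 (2 * m)]
    simp only [even_two, Even.mul_right, Even.neg_pow, one_pow]
    ring
  have t6 := tendsto_nhds_unique (t5.congr e) tendsto_const_nhds
  linarith

/-! ### The extension and the conclusion -/

/-- The continuous extension of `Δ⁻`. -/
noncomputable def deltaMinusExt (x : ℝ) : ℝ := deltaSeries x - wiltonEven |x - round x| / 2

theorem deltaMinusExt_eq_deltaMinus {x : ℝ} (hx : x ∈ deltaMinusDomain) :
    deltaMinusExt x = deltaMinus x := by
  have hi : Irrational x := hx.1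
  have hf : Int.fract (Int.fract x) = Int.fract x := Int.fract_fract x
  have h := wilton_sub_semiBrjuno_eq_deltaSeries ((deltaMinusDomain_congr hf).2 hx) hi.fract_pos
    (Int.fract_lt_one x)
  rw [wilton_congr hf, semiBrjuno_congr hf, semiBrjuno_congr (fract_neg_congr hf),
    deltaSeries_fract_congr hf] at h
  rw [deltaMinusExt, deltaMinus, oddPart, oddPart, ← h, ← (wilton_neg hi).2 hx.2.1]
  ring

lemma exists_abs_deltaMinusExt_le : ∃ B : ℝ, ∀ x, |deltaMinusExt x| ≤ B := by
  obtain ⟨B, -, hB⟩ := exists_abs_deltaSeries_le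
  obtain ⟨C, hC⟩ := isCompact_Icc.exists_bound_of_continuousOn continuousOn_wiltonEven
  refine ⟨B + C / 2, fun x => ?_⟩
  have h1 := abs_le.1 (hB x)
  have h2 := hC _ (abs_sub_round_mem_Icc x)
  rw [Real.norm_eq_abs, abs_le] at h2
  rw [deltaMinusExt, abs_le]
  constructor <;> linarith [h1.1, h1.2, h2.1, h2.2]

lemma continuousOn_deltaMinusExt : ContinuousOn deltaMinusExt {x | Irrational x} :=
  continuousOn_deltaSeries.sub (continuous_wiltonEven_abs_sub_round.div_const 2).continuousOn

lemma exists_hasSideLimits_deltaMinusExt (s : ℚ) :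
    ∃ l r : ℝ, HasSideLimits deltaMinusExt s l r ∧ r - l = 2 / s.den := by
  obtain ⟨l, r, ⟨h1, h2⟩, h3⟩ := exists_hasSideLimits_deltaSeries s
  have h4 := (continuous_wiltonEven_abs_sub_round.div_const 2).tendsto (s : ℝ)
  exact ⟨_, _, ⟨h1.sub (h4.mono_left nhdsWithin_le_nhds), h2.sub (h4.mono_left nhdsWithin_le_nhds)⟩,
    by rw [← h3]; ring⟩

theorem theorem2 :
    Dense deltaMinusDomain ∧
    ∃ (D : ℝ → ℝ) (l r : ℚ → ℝ),
      (∀ x ∈ deltaMinusDomain, D x = deltaMinus x) ∧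
      ContinuousOn D {x | Irrational x} ∧
      (∀ s : ℚ,
        Tendsto D (𝓝[{x | Irrational x ∧ x < s}] (s : ℝ)) (𝓝 (l s)) ∧
        Tendsto D (𝓝[{x | Irrational x ∧ (s : ℝ) < x}] (s : ℝ)) (𝓝 (r s)) ∧
        r s - l s = 2 / (s.den : ℝ)) ∧
      (∀ F : ℝ → ℝ, (∀ x, Irrational x → F x = D x) →
        (∀ s : ℚ, F s ∈ Set.Icc (l s) (r s)) →
        ∀ (a b : ℝ) (hab : a < b), RiemannIntegrableOn F a b hab) ∧
      (∀ F : ℝ → ℝ, (∀ x, Irrational x → F x = D x) →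
        ∀ x : ℝ, ¬ DifferentiableWithinAt ℝ F {y | Irrational y} x) := by
  refine ⟨dense_deltaMinusDomain, ?_⟩
  choose l r hlr hj using exists_hasSideLimits_deltaMinusExt
  have hl : ∀ s : ℚ, Tendsto deltaMinusExt (𝓝[{x | Irrational x ∧ x < s}] (s : ℝ)) (𝓝 (l s)) :=
    fun s => (hlr s).1.mono_left (nhdsWithin_mono _ fun x hx => hx.2)
  have hr : ∀ s : ℚ, Tendsto deltaMinusExt (𝓝[{x | Irrational x ∧ (s : ℝ) < x}] (s : ℝ))
      (𝓝 (r s)) :=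
    fun s => (hlr s).2.mono_left (nhdsWithin_mono _ fun x hx => hx.2)
  obtain ⟨B, hB⟩ := exists_abs_deltaMinusExt_le
  exact ⟨deltaMinusExt, l, r, fun x hx => deltaMinusExt_eq_deltaMinus hx,
    continuousOn_deltaMinusExt, fun s => ⟨hl s, hr s, hj s⟩,
    fun F hF hFs a b hab =>
      riemannIntegrableOn_of_mem_Icc_sideLimits continuousOn_deltaMinusExt hB hl hr hF hFs hab,
    fun F hF x => not_differentiableWithinAt_of_jump hl hr hj hF x⟩
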